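/- **Theorem (Automatic continuity of the flow map).** For $s\in\mathbb R$ let $H^s=H^s(\mathbb R^d)$ be the Sobolev space of (complex-valued) tempered distributions $u$ with $\|u\|_{H^s}=\|(I-\Delta)^{s/2}u\|_{L^2}<+\infty$, and put $H^{+\infty}=\bigcap_s H^s$, $H^{-\infty}=\bigcup_s H^s$, the latter with its locally convex inductive limit topology. Let $T\in(0,+\infty)$, $\mu\in[2,+\infty]$, let $s_0<s<s_1$ and $r>0$ be real numbers, let $u_0\in H^s$, and let $$\Phi\colon B_s(u_0,r)\to L^\mu((0,T);H^{s_0}),\qquad B_s(u_0,r)=\{v_0\in H^s;\ \|v_0-u_0\|_{H^s}<r\},$$ be a (possibly nonlinear) map with the two following properties. 1. (Weak Lipschitz) There exists $C_0>0$ such that, for all $v_0,w_0\in B_s(u_0,r)$, $$\|\Phi(v_0)-\Phi(w_0)\|_{L^\mu((0,T);H^{s_0})}\le C_0\|v_0-w_0\|_{H^{s_0}}.$$ 2. (Tame estimate) There exists $C_1>0$ such that, for all $v_0\in H^{+\infty}\cap B_s(u_0,r)$, $\Phi(v_0)$ belongs to $L^\mu((0,T);H^{s_1})$ and $$\|\Phi(v_0)\|_{L^\mu((0,T);H^{s_1})}\le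 C_1\|v_0\|_{H^{s_1}}.$$ Then the three following conclusions hold. i) For all $v_0\in B_s(u_0,r)$ we have $\Phi(v_0)\in L^\mu((0,T);H^s)$, and the map $v_0\mapsto\Phi(v_0)$ is continuous from $B_s(u_0,r)$, with the $H^s$ norm, to $L^\mu((0,T);H^s)$. ii) For all $v_0\in B_s(u_0,r)$, $$\sum_{j\ge0}\|\Delta_j\Phi(v_0)\|_{L^\mu((0,T);H^s)}^2<+\infty .$$ Here $(\Delta_j)_{j\ge 0}$ is any Littlewood–Paley decomposition: $\Delta_0=\psi(D_x)$ and $\Delta_j=\varphi(2^{-(j-1)}D_x)$ for $j\ge1$, where $D_x=-i\partial_x$ and $\psi,\varphi\in C_0^\infty(\mathbb R^d;[0,1])$ satisfy $\operatorname{supp}\psi\subset\{|\xi|\le1\}$, $\operatorname{supp}\varphi\subset\{\frac34\le|\xi|\le2\}$ and $\psi(\xi)+\sum_{p\ge0}\varphi(2^{-p}\xi)=1$ for all $\xi$. iii) Assume that $\mu=+\infty$ and that, for some $v_0\in B_s(u_0,r)$, $\Phi(v_0)\in C^0([0,T];H^{-\infty})$, that is, $\Phi(v_0)$ coincides almost everywhere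 on $(0,T)$ with a continuous function $u\colon[0,T]\to H^{-\infty}$. Then $\Phi(v_0)\in C^0([0,T];H^s)$: $u$ takes its values in $H^s$ and is continuous from $[0,T]$ to $H^s$. -/

import Mathlib

open MeasureTheory Set Filter Topology
open scoped ENNReal SchwartzMap ContDiff

noncomputable section

namespace SobolevFlow

/-- The Euclidean space `ℝ^d`. -/
abbrev Space (d : ℕ) : Type := EuclideanSpace ℝ (Fin d)

/-- Complex-valued tempered distributions on `ℝ^d`. -/
abbrev Dist (d : ℕ) : Type := 𝓢'(Space d, ℂ)

/-- The Fourier multiplier `m(D)`, `D = -i∂`. The Fourier transform of Mathlib has kernel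
`exp (-2πi x·ξ)`, hence `D` corresponds to multiplication by `2πξ`. -/
def multiplier {d : ℕ} (m : Space d → ℝ) : Dist d →L[ℂ] Dist d :=
  TemperedDistribution.fourierMultiplierCLM ℂ
    (fun ξ : Space d ↦ ((m ((2 * Real.pi) • ξ) : ℝ) : ℂ))

/-- The symbol `⟨ξ⟩^s = (1 + |ξ|²)^(s/2)`. -/
def japanese (d : ℕ) (s : ℝ) (ξ : Space d) : ℝ := (1 + ‖ξ‖ ^ 2) ^ (s / 2)

/-- The operator `⟨D⟩^s = (1 - Δ)^(s/2)` on tempered distributions. -/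
def bessel (d : ℕ) (s : ℝ) : Dist d →L[ℂ] Dist d := multiplier (japanese d s)

/-- The embedding of `L²(ℝ^d)` into the tempered distributions. -/
def ofL2 (d : ℕ) : Lp ℂ 2 (volume : Measure (Space d)) →ₗ[ℂ] Dist d :=
  (Lp.toTemperedDistributionCLM ℂ (volume : Measure (Space d)) 2).toLinearMap

/-- `H^s(ℝ^d)` as a subspace of the tempered distributions: `⟨D⟩^s u ∈ L²`. -/
def sobolevSubmodule (d : ℕ) (s : ℝ) : Submodule ℂ (Dist d) :=
  (LinearMap.range (ofL2 d)).comap (bessel d s).toLinearMap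

/-- `H^s(ℝ^d)` as a type of its own; it carries the `H^s` norm below, not the topology of
tempered distributions. -/
def SobolevSpace (d : ℕ) (s : ℝ) : Type := ↥(sobolevSubmodule d s)

instance (d : ℕ) (s : ℝ) : AddCommGroup (SobolevSpace d s) :=
  inferInstanceAs (AddCommGroup ↥(sobolevSubmodule d s))

instance (d : ℕ) (s : ℝ) : Module ℂ (SobolevSpace d s) :=
  inferInstanceAs (Module ℂ ↥(sobolevSubmodule d s))

/-- The tempered distribution underlying an element of `H^s`. -/
def SobolevSpace.toDist {d : ℕ} {s : ℝ} : SobolevSpace d s →ₗ[ℂ] Dist d :=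
  (sobolevSubmodule d s).subtype

/-- The element of `H^s` given by a tempered distribution that lies in `H^s`. -/
def SobolevSpace.mk {d : ℕ} {s : ℝ} (u : Dist d) (hu : u ∈ sobolevSubmodule d s) :
    SobolevSpace d s :=
  ⟨u, hu⟩

theorem hasTemperateGrowth_scale {d : ℕ} {m : Space d → ℝ} (hm : m.HasTemperateGrowth)
    (c : ℝ) : (fun ξ : Space d ↦ ((m (c • ξ) : ℝ) : ℂ)).HasTemperateGrowth := by
  have h1 : (fun ξ : Space d ↦ c • ξ).HasTemperateGrowth := by fun_prop
  have h2 : (fun ξ : Space d ↦ m (c • ξ)).HasTemperateGrowth := hm.comp h1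
  fun_prop

theorem japanese_hasTemperateGrowth (d : ℕ) (s : ℝ) :
    (japanese d s).HasTemperateGrowth :=
  Function.hasTemperateGrowth_one_add_norm_sq_rpow (Space d) (s / 2)

theorem bessel_bessel (d : ℕ) (s s' : ℝ) (u : Dist d) :
    bessel d s' (bessel d s u) = bessel d (s + s') u := by
  unfold bessel multiplier
  rw [TemperedDistribution.fourierMultiplierCLM_fourierMultiplierCLM_apply
    (hasTemperateGrowth_scale (japanese_hasTemperateGrowth d s) _)
    (hasTemperateGrowth_scale (japanese_hasTemperateGrowth d s') _)]
  congr 2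
  ext ξ
  simp only [Pi.mul_apply, japanese]
  norm_cast
  rw [← Real.rpow_add (by positivity)]
  congr 1
  ring

theorem bessel_zero (d : ℕ) (u : Dist d) : bessel d 0 u = u := by
  simp [bessel, multiplier, japanese]

theorem bessel_injective (d : ℕ) (s : ℝ) : Function.Injective (bessel d s) := by
  intro u v h
  have h' := congrArg (bessel d (-s)) h
  simpa [bessel_bessel, bessel_zero] using h'

theorem ofL2_injective (d : ℕ) : Function.Injective (ofL2 d) :=
  LinearMap.ker_eq_bot.mp
    (Lp.ker_toTemperedDistributionCLM_eq_bot (F := ℂ) (μ := (volume : Measure (Space d))) (p := 2))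

/-- The isometry `⟨D⟩^s : H^s → L²`. -/
def SobolevSpace.toL2 {d : ℕ} {s : ℝ} :
    SobolevSpace d s →ₗ[ℂ] Lp ℂ 2 (volume : Measure (Space d)) :=
  (LinearEquiv.ofInjective (ofL2 d) (ofL2_injective d)).symm.toLinearMap ∘ₗ
    ((bessel d s).toLinearMap.restrict (p := sobolevSubmodule d s)
      (q := LinearMap.range (ofL2 d)) fun _ h ↦ h)

theorem SobolevSpace.ofL2_toL2 {d : ℕ} {s : ℝ} (u : SobolevSpace d s) :
    ofL2 d u.toL2 = bessel d s u.toDist :=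
  congrArg Subtype.val (LinearEquiv.apply_symm_apply
    (LinearEquiv.ofInjective (ofL2 d) (ofL2_injective d)) _)

theorem SobolevSpace.toL2_injective {d : ℕ} {s : ℝ} :
    Function.Injective (SobolevSpace.toL2 (d := d) (s := s)) := by
  intro u v h
  apply Subtype.ext
  apply bessel_injective d s
  change bessel d s u.toDist = bessel d s v.toDist
  rw [← u.ofL2_toL2, ← v.ofL2_toL2, h]

/-- The norm `‖u‖_{H^s} = ‖⟨D⟩^s u‖_{L²}`. -/
instance (d : ℕ) (s : ℝ) : NormedAddCommGroup (SobolevSpace d s) :=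
  NormedAddCommGroup.induced (SobolevSpace d s) (Lp ℂ 2 (volume : Measure (Space d)))
    SobolevSpace.toL2 SobolevSpace.toL2_injective

instance (d : ℕ) (s : ℝ) : NormedSpace ℂ (SobolevSpace d s) :=
  NormedSpace.induced ℂ (SobolevSpace d s) (Lp ℂ 2 (volume : Measure (Space d)))
    SobolevSpace.toL2

theorem SobolevSpace.norm_def {d : ℕ} {s : ℝ} (u : SobolevSpace d s) : ‖u‖ = ‖u.toL2‖ := rfl

/-- A bounded Fourier multiplier maps `L²` to `L²`. -/
theorem multiplier_mem_range {d : ℕ} {m : Space d → ℝ} (hm : m.HasTemperateGrowth)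
    (hb : ∃ C, ∀ ξ, |m ξ| ≤ C) {u : Dist d} (hu : u ∈ LinearMap.range (ofL2 d)) :
    multiplier m u ∈ LinearMap.range (ofL2 d) := by
  obtain ⟨f, rfl⟩ := hu
  obtain ⟨C, hC⟩ := hb
  have h0 : TemperedDistribution.MemSobolev 0 2 (ofL2 d f) :=
    TemperedDistribution.memSobolev_zero_iff.mpr ⟨f, rfl⟩
  have h1 := h0.fourierMultiplierCLM_of_bounded
    (hasTemperateGrowth_scale hm (2 * Real.pi)) ⟨C, fun ξ ↦ by
      rw [Complex.norm_real, Real.norm_eq_abs]; exact hC _⟩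
  obtain ⟨g, hg⟩ := TemperedDistribution.memSobolev_zero_iff.mp h1
  exact ⟨g, hg.symm⟩

theorem multiplier_comm {d : ℕ} {m m' : Space d → ℝ} (hm : m.HasTemperateGrowth)
    (hm' : m'.HasTemperateGrowth) (u : Dist d) :
    multiplier m (multiplier m' u) = multiplier m' (multiplier m u) := by
  unfold multiplier
  rw [TemperedDistribution.fourierMultiplierCLM_fourierMultiplierCLM_apply
      (hasTemperateGrowth_scale hm' _) (hasTemperateGrowth_scale hm _),
    TemperedDistribution.fourierMultiplierCLM_fourierMultiplierCLM_apply
      (hasTemperateGrowth_scale hm _) (hasTemperateGrowth_scale hm' _), mul_comm]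

/-- A bounded Fourier multiplier maps `H^s` to `H^s`. -/
theorem multiplier_mem_sobolev {d : ℕ} {s : ℝ} {m : Space d → ℝ} (hm : m.HasTemperateGrowth)
    (hb : ∃ C, ∀ ξ, |m ξ| ≤ C) {u : Dist d} (hu : u ∈ sobolevSubmodule d s) :
    multiplier m u ∈ sobolevSubmodule d s := by
  have h := multiplier_mem_range hm hb (u := bessel d s u) hu
  rw [bessel, multiplier_comm hm (japanese_hasTemperateGrowth d s)] at h
  exact h

theorem sobolevSubmodule_anti (d : ℕ) {σ s : ℝ} (h : σ ≤ s) :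
    sobolevSubmodule d s ≤ sobolevSubmodule d σ := by
  intro u hu
  have hb : ∃ C, ∀ ξ, |japanese d (σ - s) ξ| ≤ C := by
    refine ⟨1, fun ξ ↦ ?_⟩
    unfold japanese
    rw [abs_of_nonneg (by positivity)]
    exact Real.rpow_le_one_of_one_le_of_nonpos (by simp) (by linarith)
  have h1 := multiplier_mem_range (japanese_hasTemperateGrowth d (σ - s)) hb
    (u := bessel d s u) hu
  have h2 : multiplier (japanese d (σ - s)) (bessel d s u) = bessel d σ u := by
    have h3 := bessel_bessel d s (σ - s) u
    rw [add_sub_cancel] at h3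
    exact h3
  rw [h2] at h1
  exact h1

/-- The inclusion `H^s ⊆ H^σ` for `σ ≤ s`. -/
def SobolevSpace.incl {d : ℕ} {σ s : ℝ} (h : σ ≤ s) : SobolevSpace d s →ₗ[ℂ] SobolevSpace d σ :=
  Submodule.inclusion (sobolevSubmodule_anti d h)

/-- `H^{-∞}(ℝ^d)`, the union (which is also the sum) of all `H^s(ℝ^d)`. -/
def SobolevNegInf (d : ℕ) : Type := ↥(⨆ s : ℝ, sobolevSubmodule d s)

instance (d : ℕ) : AddCommGroup (SobolevNegInf d) :=
  inferInstanceAs (AddCommGroup ↥(⨆ s : ℝ, sobolevSubmodule d s))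

instance (d : ℕ) : Module ℂ (SobolevNegInf d) :=
  inferInstanceAs (Module ℂ ↥(⨆ s : ℝ, sobolevSubmodule d s))

/-- The tempered distribution underlying an element of `H^{-∞}`. -/
def SobolevNegInf.toDist {d : ℕ} : SobolevNegInf d →ₗ[ℂ] Dist d :=
  (⨆ s : ℝ, sobolevSubmodule d s).subtype

/-- The inclusion `H^s ⊆ H^{-∞}`. -/
def SobolevNegInf.ofSobolev {d : ℕ} (s : ℝ) : SobolevSpace d s →ₗ[ℂ] SobolevNegInf d :=
  Submodule.inclusion (le_iSup (sobolevSubmodule d) s)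

/-- The seminorms on `H^{-∞}` whose restriction to each `H^s` is continuous. -/
def SobolevNegInf.SeminormIndex (d : ℕ) : Type :=
  {p : Seminorm ℂ (SobolevNegInf d) //
    ∀ s : ℝ, Continuous fun u : SobolevSpace d s ↦ p (SobolevNegInf.ofSobolev s u)}

instance (d : ℕ) : Nonempty (SobolevNegInf.SeminormIndex d) :=
  ⟨⟨0, fun _ ↦ continuous_const⟩⟩

/-- The family of all seminorms on `H^{-∞}` whose restriction to each `H^s` is continuous. -/
def SobolevNegInf.seminorms (d : ℕ) :
    SeminormFamily ℂ (SobolevNegInf d) (SobolevNegInf.SeminormIndex d) :=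
  fun p ↦ p.1

/-- `H^{-∞}` carries the locally convex inductive limit topology of the spaces `H^s`. -/
instance (d : ℕ) : TopologicalSpace (SobolevNegInf d) :=
  (SobolevNegInf.seminorms d).moduleFilterBasis.topology

/-- A pair of functions `(ψ, φ)` generating a Littlewood-Paley decomposition. -/
structure LittlewoodPaley (d : ℕ) where
  /-- the low frequency cutoff -/
  psi : Space d → ℝ
  /-- the annular cutoff -/
  phi : Space d → ℝ
  psi_smooth : ContDiff ℝ ∞ psi
  phi_smooth : ContDiff ℝ ∞ phi
  psi_mem : ∀ ξ, psi ξ ∈ Icc (0 : ℝ) 1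
  phi_mem : ∀ ξ, phi ξ ∈ Icc (0 : ℝ) 1
  psi_supp : tsupport psi ⊆ {ξ | ‖ξ‖ ≤ 1}
  phi_supp : tsupport phi ⊆ {ξ | 3 / 4 ≤ ‖ξ‖ ∧ ‖ξ‖ ≤ 2}
  hasSum_one : ∀ ξ, HasSum (fun p : ℕ ↦ phi ((2 ^ p : ℝ)⁻¹ • ξ)) (1 - psi ξ)

namespace LittlewoodPaley

/-- The symbol of `Δ_j`: `ψ(ξ)` for `j = 0`, `φ(2^{-(j-1)} ξ)` for `j ≥ 1`. -/
def symbol {d : ℕ} (P : LittlewoodPaley d) : ℕ → Space d → ℝ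
  | 0 => P.psi
  | p + 1 => fun ξ ↦ P.phi ((2 ^ p : ℝ)⁻¹ • ξ)

theorem symbol_hasTemperateGrowth {d : ℕ} (P : LittlewoodPaley d) (j : ℕ) :
    (P.symbol j).HasTemperateGrowth := by
  have key : ∀ f : Space d → ℝ, ContDiff ℝ ∞ f → HasCompactSupport f →
      f.HasTemperateGrowth := fun f hf hc ↦
    (hc.toSchwartzMap hf).hasTemperateGrowth
  have hpsi : HasCompactSupport P.psi :=
    HasCompactSupport.of_support_subset_isCompact (isCompact_closedBall (0 : Space d) 1)
      fun ξ hξ ↦ by simpa using P.psi_supp (subset_tsupport _ hξ)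
  have hphi : HasCompactSupport P.phi :=
    HasCompactSupport.of_support_subset_isCompact (isCompact_closedBall (0 : Space d) 2)
      fun ξ hξ ↦ by simpa using (P.phi_supp (subset_tsupport _ hξ)).2
  cases j with
  | zero => exact key _ P.psi_smooth hpsi
  | succ p =>
    have h1 : (fun ξ : Space d ↦ (2 ^ p : ℝ)⁻¹ • ξ).HasTemperateGrowth := by fun_prop
    exact (key _ P.phi_smooth hphi).comp h1

theorem symbol_bounded {d : ℕ} (P : LittlewoodPaley d) (j : ℕ) :
    ∃ C, ∀ ξ, |P.symbol j ξ| ≤ C := by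
  refine ⟨1, fun ξ ↦ ?_⟩
  cases j with
  | zero => exact abs_le.mpr ⟨le_trans (by norm_num) (P.psi_mem ξ).1, (P.psi_mem ξ).2⟩
  | succ p =>
    exact abs_le.mpr ⟨le_trans (by norm_num) (P.phi_mem _).1, (P.phi_mem _).2⟩

/-- The Littlewood-Paley block `Δ_j`, acting on `H^s`. -/
def block {d : ℕ} (P : LittlewoodPaley d) (s : ℝ) (j : ℕ) :
    SobolevSpace d s →ₗ[ℂ] SobolevSpace d s :=
  (multiplier (P.symbol j)).toLinearMap.restrict (p := sobolevSubmodule d s)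
    (q := sobolevSubmodule d s)
    fun _ h ↦ multiplier_mem_sobolev (P.symbol_hasTemperateGrowth j) (P.symbol_bounded j) h

end LittlewoodPaley

/-- Lebesgue measure on the time interval `(0,T)`. -/
def timeMeasure (T : ℝ) : Measure ℝ := volume.restrict (Ioo 0 T)

/-- The space `L^μ((0,T); H^s(ℝ^d))`. -/
abbrev TimeSobolev (d : ℕ) (T : ℝ) (μ : ℝ≥0∞) (s : ℝ) : Type :=
  Lp (SobolevSpace d s) μ (timeMeasure T)

/-- The classes `f ∈ L^μ((0,T); H^s)` and `g ∈ L^μ((0,T); H^σ)` are the same function of time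
with values in the tempered distributions. -/
def SameFunction {d : ℕ} {T : ℝ} {μ : ℝ≥0∞} {s σ : ℝ} (f : TimeSobolev d T μ s)
    (g : TimeSobolev d T μ σ) : Prop :=
  ∀ᵐ t ∂(timeMeasure T), (f t).toDist = (g t).toDist

end SobolevFlow

end

noncomputable section

namespace SobolevFlow

open FourierTransform

/-! The argument is a nonlinear interpolation carried out one dyadic frequency at a time. Let `S_k
v` be the part of `v` at frequencies below `2^k`. For large `k` it stays in the ball, and it lies in
every `H^σ`, so both hypotheses apply to the splitting `Φ(v) = Φ(S_k v) + (Φ(v) - Φ(S_k v))`. The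
tame estimate controls the first term in `H^{s₁}`, the Lipschitz estimate the second in `H^{s₀}`.
Localising to frequencies of size `2^k` and passing to `H^s` by Bernstein's inequalities, the piece
of `Φ(v)` at frequency `2^k` is bounded by `2^{k(s-s₁)} ‖S_k v‖_{H^{s₁}} + 2^{k(s-s₀)} ‖v - S_k
v‖_{H^{s₀}}`, up to a constant (`exists_norm_sq_timeMul_le`). The squares of these quantities form
`freqMass`. Because `s₀ < s < s₁` strictly, geometric series at each fixed frequency show that they
sum over `k` to at most `C ‖v‖²` in `H^s` (`exists_sum_freqMass_le`).

Hence the dyadic pieces of `Φ(v)` are square summable in `L^μ((0,T); H^s)`, for sharp annuli and for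
Littlewood–Paley blocks alike; the latter is conclusion ii. Orthogonality in `H^s` together with
Minkowski's inequality in `L^{μ/2}`, available as `μ ≥ 2`, makes the series of sharp pieces converge
in `L^μ((0,T); H^s)` (`Lp_norm_sq_le_sum`, `summable_timeMul_annulus`), and its sum is `Φ(v)`. The
tails of this series are small locally uniformly in `v`, since `freqMass` is quadratic, and each
piece is continuous in `v`. This gives continuity of the flow map
(`continuous_tsum_timeMul_annulus`).

For conclusion iii, each sharp piece of `u` is continuous in time with values in `H^s`, because
localisation is continuous on `H^{-∞}` (`continuous_localize`). The square summable bounds then make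
the series converge uniformly on `[0,T]` (`exists_continuousOn_of_summable`). -/

/-- The Hilbert space `L²(ℝ^d)`. -/
abbrev L2 (d : ℕ) : Type := Lp ℂ 2 (volume : Measure (Space d))

/-! ### Multiplication operators on the Fourier side. -/

/-- The weight `⟨2πξ⟩`, which is `⟨D⟩` in the normalisation of Mathlib's Fourier transform. -/
def weight {d : ℕ} (ξ : Space d) : ℝ := (1 + ‖(2 * Real.pi) • ξ‖ ^ 2) ^ (1 / 2 : ℝ)

theorem one_le_weight {d : ℕ} (ξ : Space d) : 1 ≤ weight ξ :=
  Real.one_le_rpow (by simp) (by norm_num)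

theorem weight_pos {d : ℕ} (ξ : Space d) : 0 < weight ξ := one_pos.trans_le (one_le_weight ξ)

theorem japanese_eq_weight_rpow {d : ℕ} (s : ℝ) (ξ : Space d) :
    japanese d s ((2 * Real.pi) • ξ) = weight ξ ^ s := by
  rw [japanese, weight, ← Real.rpow_mul (by positivity)]
  congr 1
  ring

theorem measurable_weight {d : ℕ} : Measurable (weight (d := d)) := by
  unfold weight
  fun_prop

/-- Bounded measurable functions. -/
def IsBddMeas {d : ℕ} (w : Space d → ℝ) : Prop := Measurable w ∧ ∃ C, ∀ ξ, |w ξ| ≤ C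

theorem IsBddMeas.memLp_mul {d : ℕ} {w : Space d → ℝ} (hw : IsBddMeas w) (g : L2 d) :
    MemLp (fun ξ ↦ (w ξ : ℂ) * g ξ) 2 volume := by
  obtain ⟨hm, C, hC⟩ := hw
  refine (Lp.memLp g).of_le_mul (c := C)
    ((Complex.measurable_ofReal.comp hm).aestronglyMeasurable.mul (Lp.aestronglyMeasurable g))
    (Eventually.of_forall fun ξ ↦ ?_)
  rw [norm_mul, Complex.norm_real, Real.norm_eq_abs]
  exact mul_le_mul_of_nonneg_right (hC ξ) (norm_nonneg _)

open Classical in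
/-- Multiplication by a bounded measurable function on `L²`; zero if the function is not bounded
and measurable. -/
def mulL2 {d : ℕ} (w : Space d → ℝ) : L2 d →L[ℂ] L2 d :=
  if hw : IsBddMeas w then
    LinearMap.mkContinuousOfExistsBound
      { toFun := fun g ↦ (hw.memLp_mul g).toLp _
        map_add' := fun f g ↦ by
          rw [← MemLp.toLp_add, MemLp.toLp_eq_toLp_iff]
          filter_upwards [Lp.coeFn_add f g] with ξ h
          change (w ξ : ℂ) * (f + g : L2 d) ξ = (w ξ : ℂ) * f ξ + (w ξ : ℂ) * g ξ
          rw [h, Pi.add_apply, mul_add]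
        map_smul' := fun c g ↦ by
          rw [RingHom.id_apply, ← MemLp.toLp_const_smul, MemLp.toLp_eq_toLp_iff]
          filter_upwards [Lp.coeFn_smul c g] with ξ h
          change (w ξ : ℂ) * (c • g : L2 d) ξ = c • ((w ξ : ℂ) * g ξ)
          rw [h, Pi.smul_apply, smul_eq_mul, smul_eq_mul, mul_left_comm] }
      (by
        obtain ⟨C, hC⟩ := hw.2
        refine ⟨C, fun g ↦ Lp.norm_le_mul_norm_of_ae_le_mul ?_⟩
        filter_upwards [(hw.memLp_mul g).coeFn_toLp] with ξ h
        simp only [LinearMap.coe_mk, AddHom.coe_mk, h]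
        rw [norm_mul, Complex.norm_real, Real.norm_eq_abs]
        exact mul_le_mul_of_nonneg_right (hC ξ) (norm_nonneg _))
  else 0

theorem mulL2_coeFn {d : ℕ} {w : Space d → ℝ} (hw : IsBddMeas w) (g : L2 d) :
    mulL2 w g =ᵐ[volume] fun ξ ↦ (w ξ : ℂ) * g ξ := by
  rw [mulL2, dif_pos hw]
  exact (hw.memLp_mul g).coeFn_toLp

theorem norm_mulL2_le {d : ℕ} {w : Space d → ℝ} (hw : IsBddMeas w) {C : ℝ}
    (hC : ∀ ξ, |w ξ| ≤ C) (g : L2 d) : ‖mulL2 w g‖ ≤ C * ‖g‖ := by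
  refine Lp.norm_le_mul_norm_of_ae_le_mul ?_
  filter_upwards [mulL2_coeFn hw g] with ξ h
  rw [h, norm_mul, Complex.norm_real, Real.norm_eq_abs]
  exact mul_le_mul_of_nonneg_right (hC ξ) (norm_nonneg _)

theorem norm_sq_eq_integral {d : ℕ} (g : L2 d) :
    ‖g‖ ^ 2 = ∫ ξ, ‖g ξ‖ ^ 2 := by
  have h := L2.inner_def (𝕜 := ℂ) g g
  rw [inner_self_eq_norm_sq_to_K] at h
  have h2 : ((‖g‖ ^ 2 : ℝ) : ℂ) = ((∫ ξ, ‖g ξ‖ ^ 2 : ℝ) : ℂ) := by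
    rw [← integral_complex_ofReal]
    push_cast
    refine h.trans (integral_congr_ae (Eventually.of_forall fun ξ ↦ ?_))
    simp [inner_self_eq_norm_sq_to_K]
  exact_mod_cast h2

theorem integrable_norm_sq {d : ℕ} (g : L2 d) : Integrable (fun ξ ↦ ‖g ξ‖ ^ 2) volume :=
  (memLp_two_iff_integrable_sq_norm (Lp.aestronglyMeasurable g)).1 (Lp.memLp g)

theorem norm_sq_mulL2 {d : ℕ} {w : Space d → ℝ} (hw : IsBddMeas w) (g : L2 d) :
    ‖mulL2 w g‖ ^ 2 = ∫ ξ, w ξ ^ 2 * ‖g ξ‖ ^ 2 := by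
  rw [norm_sq_eq_integral]
  refine integral_congr_ae ?_
  filter_upwards [mulL2_coeFn hw g] with ξ h
  rw [h, norm_mul, Complex.norm_real, Real.norm_eq_abs, mul_pow, sq_abs]

theorem integrable_sq_mul {d : ℕ} {w : Space d → ℝ} (hw : IsBddMeas w) (g : L2 d) :
    Integrable (fun ξ ↦ w ξ ^ 2 * ‖g ξ‖ ^ 2) volume := by
  refine (integrable_norm_sq (mulL2 w g)).congr ?_
  filter_upwards [mulL2_coeFn hw g] with ξ h
  rw [h, norm_mul, Complex.norm_real, Real.norm_eq_abs, mul_pow, sq_abs]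

/-- On `L²`, a bounded Fourier multiplier is multiplication on the Fourier side. -/
theorem multiplier_ofL2 {d : ℕ} {m : Space d → ℝ} (hm : m.HasTemperateGrowth)
    (hb : ∃ C, ∀ ξ, |m ξ| ≤ C) (g : L2 d) :
    multiplier m (ofL2 d g) =
      ofL2 d (𝓕⁻ (mulL2 (fun ξ ↦ m ((2 * Real.pi) • ξ)) (𝓕 g : L2 d)) : L2 d) := by
  have hbm : IsBddMeas (fun ξ : Space d ↦ m ((2 * Real.pi) • ξ)) := by
    obtain ⟨C, hC⟩ := hb
    exact ⟨(hm.1.continuous.comp (continuous_const_smul _)).measurable, C, fun ξ ↦ hC _⟩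
  set G : Space d → ℂ := fun ξ ↦ ((m ((2 * Real.pi) • ξ) : ℝ) : ℂ) with hG
  have hG1 : G.HasTemperateGrowth := hasTemperateGrowth_scale hm _
  have hGtop : MemLp G ∞ (volume : Measure (Space d)) := by
    obtain ⟨C, hC⟩ := hbm.2
    refine memLp_top_of_bound hG1.1.continuous.aestronglyMeasurable C
      (Eventually.of_forall fun ξ ↦ ?_)
    rw [Complex.norm_real, Real.norm_eq_abs]
    exact hC ξ
  have key : TemperedDistribution.smulLeftCLM ℂ G (ofL2 d (𝓕 g : L2 d)) =
      ofL2 d (mulL2 (fun ξ ↦ m ((2 * Real.pi) • ξ)) (𝓕 g : L2 d)) := by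
    have h := Lp.toTemperedDistribution_smul_eq (q := 2) (r := 2) hG1 hGtop (𝓕 g : L2 d)
    refine h.symm.trans ?_
    change ofL2 d _ = _
    congr 1
    ext1
    filter_upwards [Lp.coeFn_lpSMul (hGtop.toLp G) (𝓕 g : L2 d) (r := 2), hGtop.coeFn_toLp,
      mulL2_coeFn hbm (𝓕 g : L2 d)] with ξ h1 h2 h3
    rw [h1, h3, Pi.smul_apply', h2, smul_eq_mul]
  have h1 := Lp.fourier_toTemperedDistribution_eq g
  have h2 := Lp.fourierInv_toTemperedDistribution_eq
    (mulL2 (fun ξ ↦ m ((2 * Real.pi) • ξ)) (𝓕 g : L2 d))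
  rw [multiplier, TemperedDistribution.fourierMultiplierCLM_apply]
  refine Eq.trans ?_ h2
  congr 1
  refine Eq.trans ?_ key
  congr 1

/-! ### Sobolev spaces as weighted copies of `L²`. -/

namespace SobolevSpace

theorem toL2_surjective {d : ℕ} {s : ℝ} :
    Function.Surjective (toL2 (d := d) (s := s)) := by
  intro g
  have hu : bessel d s (bessel d (-s) (ofL2 d g)) = ofL2 d g := by
    rw [bessel_bessel, neg_add_cancel, bessel_zero]
  refine ⟨SobolevSpace.mk (bessel d (-s) (ofL2 d g)) ⟨g, hu.symm⟩, ofL2_injective d ?_⟩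
  rw [ofL2_toL2]
  exact hu

/-- The isometry `u ↦ ⟨ξ⟩^s û` of `H^s` onto `L²`. -/
def hat (d : ℕ) (s : ℝ) : SobolevSpace d s ≃ₗᵢ[ℂ] L2 d :=
  (LinearIsometryEquiv.ofSurjective
    { toLinearMap := toL2 (d := d) (s := s), norm_map' := fun _ ↦ rfl }
    toL2_surjective).trans (Lp.fourierTransformₗᵢ (Space d) ℂ)

theorem hat_apply {d : ℕ} {s : ℝ} (u : SobolevSpace d s) : hat d s u = (𝓕 u.toL2 : L2 d) := rfl

/-- Completeness is inherited from `L²` through the isometry `hat`; the convergence of the dyadic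
series rests on it. -/
instance (d : ℕ) (s : ℝ) : CompleteSpace (SobolevSpace d s) :=
  (completeSpace_congr (hat d s).isometry.isUniformInducing.isUniformEmbedding
    (e := (hat d s).toEquiv)).2 inferInstance

theorem toDist_injective {d : ℕ} {s : ℝ} :
    Function.Injective (toDist (d := d) (s := s)) := Subtype.val_injective

theorem toDist_incl {d : ℕ} {σ s : ℝ} (h : σ ≤ s) (u : SobolevSpace d s) :
    (incl h u).toDist = u.toDist :=
  Submodule.coe_inclusion (sobolevSubmodule_anti d h) u

theorem toDist_mem {d : ℕ} {s : ℝ} (u : SobolevSpace d s) : u.toDist ∈ sobolevSubmodule d s := u.2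

theorem toDist_mk {d : ℕ} {s : ℝ} (u : Dist d) (hu : u ∈ sobolevSubmodule d s) :
    (SobolevSpace.mk u hu).toDist = u := rfl

/-- The bridge between multipliers of distributions, which require smooth symbols, and pointwise
multiplication on `L²`. It is needed only for inclusions and Littlewood–Paley blocks; sharp cutoffs
live on the `L²` side from the start. -/
theorem hat_eq_mulL2 {d : ℕ} {s σ : ℝ} {m : Space d → ℝ} (hm : m.HasTemperateGrowth)
    (hb : ∃ C, ∀ ξ, |m ξ| ≤ C) (u : SobolevSpace d s) (v : SobolevSpace d σ)
    (h : bessel d σ v.toDist = multiplier m (bessel d s u.toDist)) :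
    hat d σ v = mulL2 (fun ξ ↦ m ((2 * Real.pi) • ξ)) (hat d s u) := by
  rw [← ofL2_toL2, ← ofL2_toL2, multiplier_ofL2 hm hb] at h
  rw [hat_apply, hat_apply, ofL2_injective d h, fourier_fourierInv_eq]

end SobolevSpace

/-! ### Fourier multipliers between Sobolev spaces. -/

/-- Symbols of Fourier multipliers which are of order at most `-a`. -/
def IsSymbol {d : ℕ} (a : ℝ) (m : Space d → ℝ) : Prop :=
  IsBddMeas fun ξ ↦ m ξ * weight ξ ^ a

theorem isSymbol_of_le {d : ℕ} {a : ℝ} {m : Space d → ℝ} (hm : Measurable m) {C : ℝ}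
    (hC : ∀ ξ, |m ξ * weight ξ ^ a| ≤ C) : IsSymbol a m :=
  ⟨hm.mul (measurable_weight.pow_const a), C, hC⟩

theorem isSymbol_of_nonpos {d : ℕ} {a : ℝ} (ha : a ≤ 0) {m : Space d → ℝ} (hm : Measurable m)
    {C : ℝ} (hC : ∀ ξ, |m ξ| ≤ C) : IsSymbol a m := by
  refine isSymbol_of_le hm (C := C) fun ξ ↦ ?_
  rw [abs_mul, abs_of_pos (Real.rpow_pos_of_pos (weight_pos ξ) a)]
  exact (mul_le_of_le_one_right (abs_nonneg _)
    (Real.rpow_le_one_of_one_le_of_nonpos (one_le_weight ξ) ha)).trans (hC ξ)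

/-- On the support the weight lies between `1` and `R`, so any power of it, positive or negative, is
at most `R^|a|`: frequency cutoffs have every order. -/
theorem isSymbol_of_support {d : ℕ} {a : ℝ} {m : Space d → ℝ} (hm : Measurable m)
    {C R : ℝ} (hC : ∀ ξ, |m ξ| ≤ C) (hR : ∀ ξ, m ξ ≠ 0 → weight ξ ≤ R) : IsSymbol a m := by
  refine isSymbol_of_le hm (C := C * |R| ^ |a|) fun ξ ↦ ?_
  have h0 : 0 ≤ C := (abs_nonneg _).trans (hC ξ)
  rw [abs_mul, abs_of_pos (Real.rpow_pos_of_pos (weight_pos ξ) a)]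
  by_cases h : m ξ = 0
  · rw [h, abs_zero, zero_mul]
    positivity
  · refine mul_le_mul (hC ξ) ?_ (Real.rpow_nonneg (weight_pos ξ).le a) h0
    exact (Real.rpow_le_rpow_of_exponent_le (one_le_weight ξ) (le_abs_self a)).trans
      (Real.rpow_le_rpow (weight_pos ξ).le ((hR ξ h).trans (le_abs_self R)) (abs_nonneg a))

theorem IsSymbol.mul {d : ℕ} {a b c : ℝ} {m m' : Space d → ℝ} (hm : IsSymbol a m)
    (hm' : IsSymbol b m') (h : a + b = c) : IsSymbol c (fun ξ ↦ m ξ * m' ξ) := by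
  obtain ⟨h1, C, hC⟩ := hm
  obtain ⟨h2, C', hC'⟩ := hm'
  have e : ∀ ξ : Space d, m ξ * m' ξ * weight ξ ^ c =
      (m ξ * weight ξ ^ a) * (m' ξ * weight ξ ^ b) := fun ξ ↦ by
    rw [← h, Real.rpow_add (weight_pos ξ)]
    ring
  unfold IsSymbol
  simp_rw [e]
  refine ⟨h1.mul h2, C * C', fun ξ ↦ ?_⟩
  rw [abs_mul]
  exact mul_le_mul (hC ξ) (hC' ξ) (abs_nonneg _) ((abs_nonneg _).trans (hC ξ))

namespace SobolevSpace

/-- The Fourier multiplier `û ↦ m û` from `H^s` to `H^σ`, for symbols of order at most `s - σ`. -/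
def fmul {d : ℕ} (s σ : ℝ) (m : Space d → ℝ) : SobolevSpace d s →L[ℂ] SobolevSpace d σ :=
  ((hat d σ).symm.toContinuousLinearEquiv : L2 d →L[ℂ] SobolevSpace d σ) ∘L
    mulL2 (fun ξ ↦ m ξ * weight ξ ^ (σ - s)) ∘L
      ((hat d s).toContinuousLinearEquiv : SobolevSpace d s →L[ℂ] L2 d)

theorem hat_fmul {d : ℕ} {s σ : ℝ} (m : Space d → ℝ) (u : SobolevSpace d s) :
    hat d σ (fmul s σ m u) = mulL2 (fun ξ ↦ m ξ * weight ξ ^ (σ - s)) (hat d s u) :=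
  (hat d σ).apply_symm_apply _

theorem hat_fmul_coeFn {d : ℕ} {s σ : ℝ} {m : Space d → ℝ} (hm : IsSymbol (σ - s) m)
    (u : SobolevSpace d s) :
    hat d σ (fmul s σ m u) =ᵐ[volume]
      fun ξ ↦ ((m ξ * weight ξ ^ (σ - s) : ℝ) : ℂ) * hat d s u ξ := by
  rw [hat_fmul]
  exact mulL2_coeFn hm _

theorem eq_of_hat_ae {d : ℕ} {s : ℝ} {u v : SobolevSpace d s}
    (h : hat d s u =ᵐ[volume] hat d s v) : u = v :=
  (hat d s).injective (Lp.ext h)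

/-- Both order conditions matter: `mulL2`, and with it `fmul`, is zero by default when the weighted
symbol is not bounded and measurable. -/
theorem fmul_fmul {d : ℕ} {s σ τ : ℝ} {m m' : Space d → ℝ} (hm : IsSymbol (σ - s) m)
    (hm' : IsSymbol (τ - σ) m') (u : SobolevSpace d s) :
    fmul σ τ m' (fmul s σ m u) = fmul s τ (fun ξ ↦ m ξ * m' ξ) u := by
  apply eq_of_hat_ae
  filter_upwards [hat_fmul_coeFn hm u, hat_fmul_coeFn hm' (fmul s σ m u),
    hat_fmul_coeFn (hm.mul hm' (by ring : _ = τ - s)) u] with ξ h1 h2 h3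
  rw [h2, h1, h3, ← mul_assoc, ← Complex.ofReal_mul]
  congr 2
  have e : τ - s = (τ - σ) + (σ - s) := by ring
  rw [e, Real.rpow_add (weight_pos ξ)]
  ring

theorem incl_eq_fmul {d : ℕ} {σ s : ℝ} (h : σ ≤ s) (u : SobolevSpace d s) :
    incl h u = fmul s σ (fun _ ↦ 1) u := by
  apply (hat d σ).injective
  rw [hat_fmul, hat_eq_mulL2 (japanese_hasTemperateGrowth d (σ - s)) _ u]
  · simp_rw [japanese_eq_weight_rpow, one_mul]
  · rw [toDist_incl]
    have := bessel_bessel d s (σ - s) u.toDist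
    rw [add_sub_cancel] at this
    exact this.symm
  · refine ⟨1, fun ξ ↦ ?_⟩
    unfold japanese
    rw [abs_of_nonneg (by positivity)]
    exact Real.rpow_le_one_of_one_le_of_nonpos (by simp) (by linarith)

theorem isSymbol_one {d : ℕ} {a : ℝ} (ha : a ≤ 0) : IsSymbol a (fun _ : Space d ↦ (1 : ℝ)) :=
  isSymbol_of_nonpos ha measurable_const (C := 1) (by simp)

theorem toDist_fmul {d : ℕ} {s σ τ : ℝ} {m : Space d → ℝ} (hσ : IsSymbol (σ - s) m)
    (hτ : IsSymbol (τ - s) m) (u : SobolevSpace d s) :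
    (fmul s σ m u).toDist = (fmul s τ m u).toDist := by
  have key : ∀ {σ τ : ℝ}, IsSymbol (σ - s) m → τ ≤ σ →
      (fmul s σ m u).toDist = (fmul s τ m u).toDist := fun {σ τ} hσ h ↦ by
    rw [← toDist_incl h, incl_eq_fmul, fmul_fmul hσ (isSymbol_one (by linarith))]
    simp_rw [mul_one]
  rcases le_total τ σ with h | h
  · exact key hσ h
  · exact (key hτ h).symm

theorem norm_incl_le {d : ℕ} {σ s : ℝ} (h : σ ≤ s) (u : SobolevSpace d s) :
    ‖incl h u‖ ≤ ‖u‖ := by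
  rw [← (hat d σ).norm_map, ← (hat d s).norm_map u, incl_eq_fmul, hat_fmul]
  refine (norm_mulL2_le (isSymbol_one (by linarith)) (C := 1) (fun ξ ↦ ?_) _).trans_eq (one_mul _)
  rw [one_mul, abs_of_pos (Real.rpow_pos_of_pos (weight_pos ξ) _)]
  exact Real.rpow_le_one_of_one_le_of_nonpos (one_le_weight ξ) (by linarith)

theorem fmul_eq_of_toDist_eq_of_le {d : ℕ} {s σ τ : ℝ} (hσs : σ ≤ s) {m : Space d → ℝ}
    (hσ : IsSymbol (τ - σ) m) {u : SobolevSpace d s} {v : SobolevSpace d σ}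
    (h : u.toDist = v.toDist) : fmul s τ m u = fmul σ τ m v := by
  have hv : v = fmul s σ (fun _ ↦ 1) u := by
    rw [← incl_eq_fmul hσs]
    exact toDist_injective (h.symm.trans (toDist_incl hσs u).symm)
  rw [hv, fmul_fmul (isSymbol_one (by linarith)) hσ]
  simp_rw [one_mul]

/-- A multiplier depends only on the underlying distribution, since the smaller space embeds in the
larger one by the multiplier with symbol `1`. This allows `Φ(v)` to be read in `H^{s₀}`, `H^s` or
`H^{s₁}` as convenient. -/
theorem fmul_eq_of_toDist_eq {d : ℕ} {s σ τ : ℝ} {m : Space d → ℝ} (hs : IsSymbol (τ - s) m)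
    (hσ : IsSymbol (τ - σ) m) {u : SobolevSpace d s} {v : SobolevSpace d σ}
    (h : u.toDist = v.toDist) : fmul s τ m u = fmul σ τ m v := by
  rcases le_total σ s with hle | hle
  · exact fmul_eq_of_toDist_eq_of_le hle hσ h
  · exact (fmul_eq_of_toDist_eq_of_le hle hs h.symm).symm

theorem norm_fmul_le {d : ℕ} {s σ : ℝ} {m : Space d → ℝ} (hm : Measurable m) {C : ℝ}
    (hC : ∀ ξ, |m ξ * weight ξ ^ (σ - s)| ≤ C) (u : SobolevSpace d s) :
    ‖fmul s σ m u‖ ≤ C * ‖u‖ := by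
  rw [← (hat d σ).norm_map, hat_fmul, ← (hat d s).norm_map u]
  exact norm_mulL2_le (isSymbol_of_le hm hC) hC _

theorem norm_sq_fmul {d : ℕ} {s σ : ℝ} {m : Space d → ℝ} (hm : IsSymbol (σ - s) m)
    (u : SobolevSpace d s) :
    ‖fmul s σ m u‖ ^ 2 = ∫ ξ, (m ξ * weight ξ ^ (σ - s)) ^ 2 * ‖hat d s u ξ‖ ^ 2 := by
  rw [← (hat d σ).norm_map, hat_fmul]
  exact norm_sq_mulL2 hm _

theorem fmul_sum {d : ℕ} {s σ : ℝ} {ι : Type*} (A : Finset ι) {m : ι → Space d → ℝ}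
    (hm : ∀ i ∈ A, IsSymbol (σ - s) (m i)) (hA : IsSymbol (σ - s) fun ξ ↦ ∑ i ∈ A, m i ξ)
    (u : SobolevSpace d s) :
    fmul s σ (fun ξ ↦ ∑ i ∈ A, m i ξ) u = ∑ i ∈ A, fmul s σ (m i) u := by
  apply eq_of_hat_ae
  rw [map_sum]
  have h : ∀ i ∈ A, ∀ᵐ ξ ∂volume, hat d σ (fmul s σ (m i) u) ξ =
      ((m i ξ * weight ξ ^ (σ - s) : ℝ) : ℂ) * hat d s u ξ :=
    fun i hi ↦ hat_fmul_coeFn (hm i hi) u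
  rw [← Finset.eventually_all] at h
  filter_upwards [hat_fmul_coeFn hA u, h, Lp.coeFn_finsetSum A fun i ↦ hat d σ (fmul s σ (m i) u)]
    with ξ h1 h2 h3
  rw [h1, h3, Finset.sum_apply, Finset.sum_congr rfl h2, ← Finset.sum_mul, Finset.sum_mul,
    Complex.ofReal_sum]

/-- Square function bound for families of Fourier multipliers. -/
theorem sum_norm_sq_fmul_le {d : ℕ} {s σ : ℝ} {ι : Type*} (A : Finset ι) {m : ι → Space d → ℝ}
    (hm : ∀ i ∈ A, IsSymbol (σ - s) (m i)) (c : ι → ℝ) {C : ℝ}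
    (hC : ∀ ξ, ∑ i ∈ A, c i * (m i ξ * weight ξ ^ (σ - s)) ^ 2 ≤ C) (u : SobolevSpace d s) :
    ∑ i ∈ A, c i * ‖fmul s σ (m i) u‖ ^ 2 ≤ C * ‖u‖ ^ 2 := by
  rw [Finset.sum_congr rfl fun i hi ↦ by rw [norm_sq_fmul (hm i hi) u, ← integral_const_mul],
    ← integral_finsetSum _ fun i hi ↦ (integrable_sq_mul (hm i hi) _).const_mul _,
    ← (hat d s).norm_map u, norm_sq_eq_integral, ← integral_const_mul]
  refine integral_mono (integrable_finsetSum _ fun i hi ↦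
    (integrable_sq_mul (hm i hi) _).const_mul _) ((integrable_norm_sq _).const_mul _) fun ξ ↦ ?_
  have := mul_le_mul_of_nonneg_right (hC ξ) (sq_nonneg ‖hat d s u ξ‖)
  rw [Finset.sum_mul] at this
  simpa only [mul_assoc] using this

/-- Almost orthogonality for families of Fourier multipliers. -/
theorem norm_sq_sum_fmul_le {d : ℕ} {s σ : ℝ} {ι : Type*} (A : Finset ι) {m : ι → Space d → ℝ}
    (hm : ∀ i ∈ A, IsSymbol (σ - s) (m i)) (hA : IsSymbol (σ - s) fun ξ ↦ ∑ i ∈ A, m i ξ)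
    (hle : ∀ ξ, (∑ i ∈ A, m i ξ) ^ 2 ≤ ∑ i ∈ A, m i ξ ^ 2) (u : SobolevSpace d s) :
    ‖∑ i ∈ A, fmul s σ (m i) u‖ ^ 2 ≤ ∑ i ∈ A, ‖fmul s σ (m i) u‖ ^ 2 := by
  rw [← fmul_sum A hm hA, norm_sq_fmul hA,
    Finset.sum_congr rfl fun i hi ↦ norm_sq_fmul (hm i hi) u,
    ← integral_finsetSum _ fun i hi ↦ integrable_sq_mul (hm i hi) _]
  refine integral_mono (integrable_sq_mul hA _) (integrable_finsetSum _ fun i hi ↦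
    integrable_sq_mul (hm i hi) _) fun ξ ↦ ?_
  simp only [mul_pow, ← Finset.sum_mul]
  gcongr
  exact hle ξ

end SobolevSpace

theorem LittlewoodPaley.block_eq_fmul {d : ℕ} (P : LittlewoodPaley d) (s : ℝ) (j : ℕ)
    (u : SobolevSpace d s) :
    P.block s j u = SobolevSpace.fmul s s (fun ξ ↦ P.symbol j ((2 * Real.pi) • ξ)) u := by
  apply (SobolevSpace.hat d s).injective
  rw [SobolevSpace.hat_fmul, SobolevSpace.hat_eq_mulL2 (P.symbol_hasTemperateGrowth j)
    (P.symbol_bounded j) u]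
  · simp
  · exact multiplier_comm (japanese_hasTemperateGrowth d s) (P.symbol_hasTemperateGrowth j) _

/-! ### Dyadic frequency cutoffs and Bernstein inequalities. -/

/-- The indicator function of the dyadic annulus `2^k ≤ ⟨2πξ⟩ < 2^(k+1)`. -/
def annulus {d : ℕ} (k : ℕ) (ξ : Space d) : ℝ :=
  if 2 ^ k ≤ weight ξ ∧ weight ξ < 2 ^ (k + 1) then 1 else 0

/-- The indicator function of the frequencies `⟨2πξ⟩ < 2^k`. -/
def low {d : ℕ} (k : ℕ) (ξ : Space d) : ℝ := if weight ξ < 2 ^ k then 1 else 0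

/-- The indicator function of the frequencies `⟨2πξ⟩ ≥ 2^k`. -/
def high {d : ℕ} (k : ℕ) (ξ : Space d) : ℝ := if weight ξ < 2 ^ k then 0 else 1

theorem measurable_annulus {d : ℕ} (k : ℕ) : Measurable (annulus (d := d) k) :=
  Measurable.ite ((measurableSet_le measurable_const measurable_weight).inter
    (measurableSet_lt measurable_weight measurable_const)) measurable_const measurable_const

theorem measurable_low {d : ℕ} (k : ℕ) : Measurable (low (d := d) k) :=
  Measurable.ite (measurableSet_lt measurable_weight measurable_const)
    measurable_const measurable_const

theorem measurable_high {d : ℕ} (k : ℕ) : Measurable (high (d := d) k) :=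
  Measurable.ite (measurableSet_lt measurable_weight measurable_const)
    measurable_const measurable_const

theorem abs_low_le {d : ℕ} (k : ℕ) (ξ : Space d) : |low k ξ| ≤ 1 := by
  unfold low
  split_ifs <;> simp

theorem abs_high_le {d : ℕ} (k : ℕ) (ξ : Space d) : |high k ξ| ≤ 1 := by
  unfold high
  split_ifs <;> simp

theorem isSymbol_low {d : ℕ} (k : ℕ) (a : ℝ) : IsSymbol a (low (d := d) k) := by
  refine isSymbol_of_support (measurable_low k) (abs_low_le k) (R := 2 ^ k) fun ξ h ↦ ?_
  by_contra hc
  exact h (if_neg fun h' ↦ hc h'.le)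

theorem isSymbol_high {d : ℕ} (k : ℕ) {a : ℝ} (ha : a ≤ 0) : IsSymbol a (high (d := d) k) :=
  isSymbol_of_nonpos ha (measurable_high k) (abs_high_le k)

/-- Symbols supported where `⟨2πξ⟩` is comparable to `2^k`. -/
structure IsDyadic {d : ℕ} (k : ℕ) (m : Space d → ℝ) : Prop where
  measurable : Measurable m
  abs_le : ∀ ξ, |m ξ| ≤ 1
  le_weight : ∀ ξ, m ξ ≠ 0 → 2 ^ k / 4 ≤ weight ξ
  weight_le : ∀ ξ, m ξ ≠ 0 → weight ξ ≤ 2 * 2 ^ k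

theorem IsDyadic.isSymbol {d : ℕ} {k : ℕ} {m : Space d → ℝ} (hm : IsDyadic k m) (a : ℝ) :
    IsSymbol a m :=
  isSymbol_of_support hm.measurable hm.abs_le hm.weight_le

/-- Bernstein's inequality for a gain of derivatives: the weight is at most `2 * 2^k` on the
support. The companion for a loss uses the lower bound `2^k / 4`. -/
theorem IsDyadic.norm_fmul_le_of_le {d : ℕ} {k : ℕ} {m : Space d → ℝ} (hm : IsDyadic k m)
    {s σ : ℝ} (h : s ≤ σ) (u : SobolevSpace d s) :
    ‖SobolevSpace.fmul s σ m u‖ ≤ 2 ^ (σ - s) * (2 ^ k : ℝ) ^ (σ - s) * ‖u‖ := by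
  refine SobolevSpace.norm_fmul_le hm.measurable (fun ξ ↦ ?_) u
  rw [abs_mul, abs_of_pos (Real.rpow_pos_of_pos (weight_pos ξ) _)]
  by_cases h0 : m ξ = 0
  · rw [h0, abs_zero, zero_mul]
    positivity
  · rw [← Real.mul_rpow (by positivity) (by positivity)]
    exact (mul_le_of_le_one_left (Real.rpow_nonneg (weight_pos ξ).le _) (hm.abs_le ξ)).trans
      (Real.rpow_le_rpow (weight_pos ξ).le (hm.weight_le ξ h0) (sub_nonneg.2 h))

theorem IsDyadic.norm_fmul_le_of_ge {d : ℕ} {k : ℕ} {m : Space d → ℝ} (hm : IsDyadic k m)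
    {s σ : ℝ} (h : σ ≤ s) (u : SobolevSpace d s) :
    ‖SobolevSpace.fmul s σ m u‖ ≤ 4 ^ (s - σ) * (2 ^ k : ℝ) ^ (σ - s) * ‖u‖ := by
  refine SobolevSpace.norm_fmul_le hm.measurable (fun ξ ↦ ?_) u
  rw [abs_mul, abs_of_pos (Real.rpow_pos_of_pos (weight_pos ξ) _)]
  by_cases h0 : m ξ = 0
  · rw [h0, abs_zero, zero_mul]
    positivity
  · have e : (4 : ℝ) ^ (s - σ) * (2 ^ k : ℝ) ^ (σ - s) = (2 ^ k / 4 : ℝ) ^ (σ - s) := by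
      rw [Real.div_rpow (by positivity) (by norm_num), ← neg_sub σ s,
        Real.rpow_neg (by norm_num), div_eq_inv_mul]
    rw [e]
    exact (mul_le_of_le_one_left (Real.rpow_nonneg (weight_pos ξ).le _) (hm.abs_le ξ)).trans
      (Real.rpow_le_rpow_of_nonpos (by positivity) (hm.le_weight ξ h0) (sub_nonpos.2 h))

theorem isDyadic_annulus {d : ℕ} (k : ℕ) : IsDyadic k (annulus (d := d) k) where
  measurable := measurable_annulus k
  abs_le ξ := by
    unfold annulus
    split_ifs <;> simp
  le_weight ξ h := by
    have h' : 2 ^ k ≤ weight ξ ∧ weight ξ < 2 ^ (k + 1) := by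
      by_contra hc
      exact h (if_neg hc)
    have : (0 : ℝ) < 2 ^ k := by positivity
    linarith [h'.1]
  weight_le ξ h := by
    have h' : 2 ^ k ≤ weight ξ ∧ weight ξ < 2 ^ (k + 1) := by
      by_contra hc
      exact h (if_neg hc)
    have := h'.2
    rw [pow_succ] at this
    linarith

theorem norm_le_weight {d : ℕ} (ξ : Space d) : ‖(2 * Real.pi) • ξ‖ ≤ weight ξ := by
  rw [weight, ← Real.sqrt_eq_rpow]
  exact Real.le_sqrt_of_sq_le (by linarith)

theorem weight_le_of_norm_le {d : ℕ} {ξ : Space d} {R : ℝ} (hR : 1 ≤ R)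
    (h : ‖(2 * Real.pi) • ξ‖ ≤ R) : weight ξ ≤ 2 * R := by
  rw [weight, ← Real.sqrt_eq_rpow]
  refine Real.sqrt_le_iff.2 ⟨by linarith, ?_⟩
  nlinarith [norm_nonneg ((2 * Real.pi) • ξ)]

/-- The constants of `IsDyadic` are loose enough for both kinds of cutoff. For `j = p + 1` the
support is `3/8 * 2^j ≤ |η| ≤ 2^j` with `η = 2πξ`, and `|η| ≤ ⟨η⟩ ≤ 2 max(1, |η|)`. -/
theorem LittlewoodPaley.isDyadic_symbol {d : ℕ} (P : LittlewoodPaley d) (j : ℕ) :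
    IsDyadic j (fun ξ : Space d ↦ P.symbol j ((2 * Real.pi) • ξ)) := by
  have hmeas : Measurable (fun ξ : Space d ↦ P.symbol j ((2 * Real.pi) • ξ)) :=
    ((P.symbol_hasTemperateGrowth j).1.continuous.comp (continuous_const_smul _)).measurable
  cases j with
  | zero =>
    refine ⟨hmeas, fun ξ ↦ ?_, fun ξ _ ↦ ?_, fun ξ h ↦ ?_⟩
    · exact abs_le.mpr ⟨le_trans (by norm_num) (P.psi_mem _).1, (P.psi_mem _).2⟩
    · exact le_trans (by norm_num) (one_le_weight ξ)
    · have := weight_le_of_norm_le le_rfl (P.psi_supp (subset_tsupport _ h))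
      simpa using this
  | succ p =>
    have hsupp : ∀ ξ : Space d, P.symbol (p + 1) ((2 * Real.pi) • ξ) ≠ 0 →
        3 / 4 * 2 ^ p ≤ ‖(2 * Real.pi) • ξ‖ ∧ ‖(2 * Real.pi) • ξ‖ ≤ 2 * 2 ^ p := by
      intro ξ h
      have := P.phi_supp (subset_tsupport _ h)
      rw [mem_ofPred_eq, norm_smul _ ((2 * Real.pi) • ξ), norm_inv, norm_pow, Real.norm_ofNat,
        ← div_eq_inv_mul, le_div_iff₀ (by positivity), div_le_iff₀ (by positivity)] at this
      exact this
    refine ⟨hmeas, fun ξ ↦ ?_, fun ξ h ↦ ?_, fun ξ h ↦ ?_⟩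
    · exact abs_le.mpr ⟨le_trans (by norm_num) (P.phi_mem _).1, (P.phi_mem _).2⟩
    · refine le_trans ?_ ((hsupp ξ h).1.trans (norm_le_weight ξ))
      rw [pow_succ]
      have : (0 : ℝ) < 2 ^ p := by positivity
      linarith
    · refine weight_le_of_norm_le (one_le_pow₀ one_le_two) ((hsupp ξ h).2.trans ?_)
      rw [pow_succ, mul_comm]

/-- The annuli partition the whole frequency space, with no low frequency remainder, because the
weight is at least `1`. -/
theorem exists_annulus_eq {d : ℕ} (ξ : Space d) :
    ∃ n : ℕ, 2 ^ n ≤ weight ξ ∧ weight ξ < 2 ^ (n + 1) ∧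
      ∀ k, annulus k ξ = if k = n then 1 else 0 := by
  obtain ⟨n, h1, h2⟩ := exists_nat_pow_near (one_le_weight ξ) (one_lt_two (α := ℝ))
  refine ⟨n, h1, h2, fun k ↦ ?_⟩
  unfold annulus
  congr 1
  refine propext ⟨fun h ↦ ?_, fun h ↦ h ▸ ⟨h1, h2⟩⟩
  have h3 := (pow_lt_pow_iff_right₀ (one_lt_two (α := ℝ))).1 (h.1.trans_lt h2)
  have h4 := (pow_lt_pow_iff_right₀ (one_lt_two (α := ℝ))).1 (h1.trans_lt h.2)
  omega

theorem sum_annulus_sq_le {d : ℕ} (A : Finset ℕ) (ξ : Space d) :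
    (∑ k ∈ A, annulus k ξ) ^ 2 ≤ ∑ k ∈ A, annulus k ξ ^ 2 := by
  obtain ⟨n, -, -, h⟩ := exists_annulus_eq ξ
  simp only [h, Finset.sum_ite_eq', ite_pow, one_pow, ne_eq, OfNat.ofNat_ne_zero,
    not_false_eq_true, zero_pow, le_refl]

theorem isSymbol_sum_annulus {d : ℕ} (A : Finset ℕ) (a : ℝ) :
    IsSymbol a (fun ξ : Space d ↦ ∑ k ∈ A, annulus k ξ) := by
  refine isSymbol_of_support (Finset.measurable_fun_sum A fun k _ ↦ measurable_annulus k) (C := 1)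
    (R := ∑ k ∈ A, 2 * 2 ^ k) (fun ξ ↦ ?_) fun ξ h ↦ ?_
  · obtain ⟨n, -, -, h⟩ := exists_annulus_eq ξ
    simp only [h, Finset.sum_ite_eq']
    split_ifs <;> simp
  · obtain ⟨k, hk, hne⟩ := Finset.exists_ne_zero_of_sum_ne_zero h
    exact ((isDyadic_annulus k).weight_le ξ hne).trans
      (Finset.single_le_sum (f := fun k : ℕ ↦ (2 * 2 ^ k : ℝ)) (fun _ _ ↦ by positivity) hk)

namespace SobolevSpace

theorem norm_sq_sum_annulus_le {d : ℕ} {s σ : ℝ} (A : Finset ℕ) (u : SobolevSpace d s) :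
    ‖∑ k ∈ A, fmul s σ (annulus k) u‖ ^ 2 ≤ ∑ k ∈ A, ‖fmul s σ (annulus k) u‖ ^ 2 :=
  norm_sq_sum_fmul_le A (fun k _ ↦ (isDyadic_annulus k).isSymbol _) (isSymbol_sum_annulus A _)
    (sum_annulus_sq_le A) u

theorem fmul_annulus_annulus {d : ℕ} {s σ τ : ℝ} (k l : ℕ) (u : SobolevSpace d s) :
    fmul σ τ (annulus l) (fmul s σ (annulus k) u) =
      if k = l then fmul s τ (annulus l) u else 0 := by
  rw [fmul_fmul ((isDyadic_annulus k).isSymbol _) ((isDyadic_annulus l).isSymbol _)]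
  split_ifs with h
  · subst h
    congr 2
    ext ξ
    unfold annulus
    split_ifs <;> simp
  · have e : (fun ξ : Space d ↦ annulus k ξ * annulus l ξ) = fun _ ↦ 0 := by
      ext ξ
      obtain ⟨n, -, -, hn⟩ := exists_annulus_eq ξ
      rw [hn, hn]
      split_ifs with h1 h2
      · exact absurd (h1.trans h2.symm) h
      all_goals simp
    rw [e, ← norm_le_zero_iff]
    refine (norm_fmul_le measurable_const (C := 0) (by simp) u).trans (by simp)

/-- The annuli cover all frequencies and are countably many, so the exceptional null sets can be
united. -/
theorem eq_of_fmul_annulus_eq {d : ℕ} {s τ : ℝ} {u v : SobolevSpace d s}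
    (h : ∀ k, fmul s τ (annulus k) u = fmul s τ (annulus k) v) : u = v := by
  apply eq_of_hat_ae
  have h1 : ∀ k : ℕ, ∀ᵐ ξ ∂(volume : Measure (Space d)),
      ((annulus k ξ * weight ξ ^ (τ - s) : ℝ) : ℂ) * hat d s u ξ =
        ((annulus k ξ * weight ξ ^ (τ - s) : ℝ) : ℂ) * hat d s v ξ := by
    intro k
    filter_upwards [hat_fmul_coeFn ((isDyadic_annulus k).isSymbol (τ - s)) u,
      hat_fmul_coeFn ((isDyadic_annulus k).isSymbol (τ - s)) v] with ξ h1 h2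
    rw [← h1, ← h2, h k]
  filter_upwards [ae_all_iff.2 h1] with ξ hξ
  obtain ⟨n, -, -, hn⟩ := exists_annulus_eq ξ
  have := hξ n
  rw [hn, if_pos rfl, one_mul] at this
  exact mul_left_cancel₀
    (Complex.ofReal_ne_zero.2 (Real.rpow_pos_of_pos (weight_pos ξ) _).ne') this

theorem toDist_eq_of_fmul_annulus_eq {d : ℕ} {s σ : ℝ} {u : SobolevSpace d s}
    {v : SobolevSpace d σ} (τ : ℝ)
    (h : ∀ k, fmul s τ (annulus k) u = fmul σ τ (annulus k) v) : u.toDist = v.toDist := by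
  rw [← toDist_incl (min_le_left s σ) u, ← toDist_incl (min_le_right s σ) v]
  congr 1
  refine eq_of_fmul_annulus_eq (τ := τ) fun k ↦ ?_
  rw [fmul_eq_of_toDist_eq ((isDyadic_annulus k).isSymbol _) ((isDyadic_annulus k).isSymbol _)
      (toDist_incl (min_le_left s σ) u), h k,
    fmul_eq_of_toDist_eq ((isDyadic_annulus k).isSymbol _) ((isDyadic_annulus k).isSymbol _)
      (toDist_incl (min_le_right s σ) v)]

/-- The complementary cutoff has order `0` only, which is why the target must be a weaker space.
With `σ = s₀` this is the difference that the Lipschitz hypothesis sees. -/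
theorem sub_fmul_low {d : ℕ} {s σ : ℝ} (h : σ ≤ s) (k : ℕ) (u : SobolevSpace d s) :
    incl h (u - fmul s s (low k) u) = fmul s σ (high k) u := by
  apply eq_of_hat_ae
  rw [map_sub, incl_eq_fmul, incl_eq_fmul, fmul_fmul (isSymbol_low k _)
    (isSymbol_one (by linarith)), map_sub]
  have h1 : IsSymbol (σ - s) (fun ξ : Space d ↦ low k ξ * 1) := by
    simpa using isSymbol_low (d := d) k (σ - s)
  filter_upwards [hat_fmul_coeFn (isSymbol_one (by linarith : σ - s ≤ 0)) u,
    hat_fmul_coeFn h1 u, hat_fmul_coeFn (isSymbol_high k (by linarith : σ - s ≤ 0)) u,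
    Lp.coeFn_sub (hat d σ (fmul s σ (fun _ ↦ 1) u)) (hat d σ (fmul s σ (fun ξ ↦ low k ξ * 1) u))]
    with ξ e1 e2 e3 e4
  rw [e4, Pi.sub_apply, e1, e2, e3, ← sub_mul, ← Complex.ofReal_sub, ← sub_mul]
  congr 3
  unfold low high
  split_ifs <;> simp

/-- Dominated convergence on the Fourier side: at each frequency the high cutoff eventually
vanishes. -/
theorem tendsto_fmul_low {d : ℕ} {s : ℝ} (u : SobolevSpace d s) :
    Tendsto (fun k ↦ fmul s s (low k) u) atTop (𝓝 u) := by
  rw [tendsto_iff_norm_sub_tendsto_zero]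
  have e : ∀ k, ‖fmul s s (low k) u - u‖ ^ 2 = ∫ ξ, high k ξ ^ 2 * ‖hat d s u ξ‖ ^ 2 := by
    intro k
    have h1 : incl le_rfl (u - fmul s s (low k) u) = u - fmul s s (low k) u :=
      toDist_injective (toDist_incl le_rfl _)
    rw [norm_sub_rev, ← h1, sub_fmul_low, norm_sq_fmul (isSymbol_high k (by simp))]
    simp
  have h : Tendsto (fun k ↦ ‖fmul s s (low k) u - u‖ ^ 2) atTop (𝓝 0) := by
    simp_rw [e]
    rw [← integral_zero (Space d) ℝ]
    refine tendsto_integral_of_dominated_convergence (fun ξ ↦ ‖hat d s u ξ‖ ^ 2)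
      (fun k ↦ ((measurable_high k).pow_const 2).aestronglyMeasurable.mul
        (integrable_norm_sq _).aestronglyMeasurable) (integrable_norm_sq _)
      (fun k ↦ Eventually.of_forall fun ξ ↦ ?_) (Eventually.of_forall fun ξ ↦ ?_)
    · rw [norm_mul, norm_pow, norm_pow, Real.norm_eq_abs, norm_norm]
      exact mul_le_of_le_one_left (sq_nonneg _) (pow_le_one₀ (abs_nonneg _) (abs_high_le k ξ))
    · refine tendsto_const_nhds.congr' ?_
      obtain ⟨n, hn⟩ := pow_unbounded_of_one_lt (weight ξ) (one_lt_two (α := ℝ))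
      filter_upwards [eventually_ge_atTop n] with k hk
      rw [high, if_pos (hn.trans_le (pow_le_pow_right₀ one_le_two hk))]
      simp
  have := h.sqrt
  simpa using this

/-! ### The square function `freqMass` and its summability. -/

/-- The square function measuring the part of `v ∈ H^s` which is seen at frequency `2^k`. -/
def freqMass {d : ℕ} (s₀ : ℝ) {s : ℝ} (s₁ : ℝ) (k : ℕ) (v : SobolevSpace d s) : ℝ :=
  ((2 ^ k : ℝ) ^ (s - s₁) * ‖fmul s s₁ (low k) v‖) ^ 2 +
    ((2 ^ k : ℝ) ^ (s - s₀) * ‖fmul s s₀ (high k) v‖) ^ 2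

theorem freqMass_nonneg {d : ℕ} (s₀ : ℝ) {s : ℝ} (s₁ : ℝ) (k : ℕ) (v : SobolevSpace d s) :
    0 ≤ freqMass s₀ s₁ k v := add_nonneg (sq_nonneg _) (sq_nonneg _)

/-- This is `(a + b)² ≤ 2a² + 2b²`. It bounds tails for `w` near `v` by the tail at `v` plus a term
of size `‖w - v‖²`. -/
theorem freqMass_le {d : ℕ} (s₀ : ℝ) {s : ℝ} (s₁ : ℝ) (k : ℕ) (v w : SobolevSpace d s) :
    freqMass s₀ s₁ k v ≤ 2 * freqMass s₀ s₁ k w + 2 * freqMass s₀ s₁ k (v - w) := by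
  have key : ∀ (c : ℝ) (_ : 0 ≤ c) (σ : ℝ) (L : SobolevSpace d s →L[ℂ] SobolevSpace d σ),
      (c * ‖L v‖) ^ 2 ≤ 2 * (c * ‖L w‖) ^ 2 + 2 * (c * ‖L (v - w)‖) ^ 2 := by
    intro c hc σ L
    have h1 : ‖L v‖ ≤ ‖L w‖ + ‖L (v - w)‖ := by
      have : L v = L w + L (v - w) := by rw [← map_add, add_sub_cancel]
      rw [this]
      exact norm_add_le _ _
    have h2 : c * ‖L v‖ ≤ c * ‖L w‖ + c * ‖L (v - w)‖ := by
      rw [← mul_add]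
      exact mul_le_mul_of_nonneg_left h1 hc
    have h3 := pow_le_pow_left₀ (by positivity) h2 2
    linarith [sq_nonneg (c * ‖L w‖ - c * ‖L (v - w)‖)]
  have h1 := key ((2 ^ k : ℝ) ^ (s - s₁)) (by positivity) s₁ (fmul s s₁ (low k))
  have h2 := key ((2 ^ k : ℝ) ^ (s - s₀)) (by positivity) s₀ (fmul s s₀ (high k))
  unfold freqMass
  linarith

end SobolevSpace

theorem sum_geometric_comp_le {δ : ℝ} (hδ : 0 < δ) (B : Finset ℕ) (f : ℕ → ℕ)
    (hf : Set.InjOn f B) :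
    ∑ k ∈ B, (((1 / 2 : ℝ) ^ f k) ^ δ) ^ 2 ≤ (1 - ((1 / 2 : ℝ) ^ δ) ^ 2)⁻¹ := by
  have h0 : 0 ≤ (1 / 2 : ℝ) ^ δ := by positivity
  have h1 : ((1 / 2 : ℝ) ^ δ) ^ 2 < 1 :=
    pow_lt_one₀ h0 (Real.rpow_lt_one (by norm_num) (by norm_num) hδ) two_ne_zero
  have e : ∀ n : ℕ, (((1 / 2 : ℝ) ^ n) ^ δ) ^ 2 = (((1 / 2 : ℝ) ^ δ) ^ 2) ^ n := fun n ↦ by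
    rw [← Real.rpow_pow_comm (by norm_num), pow_right_comm]
  simp_rw [e]
  rw [← Finset.sum_image (f := fun n ↦ (((1 / 2 : ℝ) ^ δ) ^ 2) ^ n) hf,
    ← tsum_geometric_of_lt_one (by positivity) h1]
  exact (summable_geometric_of_lt_one (by positivity) h1).sum_le_tsum _ fun _ _ ↦ by positivity

/-- If `2^n ≤ ⟨2πξ⟩ < 2^(n+1)`, only `k ≥ n + 1` contribute, and there the terms are dominated by a
geometric sequence in `k - (n + 1)`. Its ratio is below `1` precisely because `s < s₁`, and the
bound does not depend on `ξ`. -/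
theorem sum_low_le {d : ℕ} {s s₁ : ℝ} (h : s < s₁) (A : Finset ℕ) (ξ : Space d) :
    ∑ k ∈ A, ((2 ^ k : ℝ) ^ (s - s₁)) ^ 2 * (low k ξ * weight ξ ^ (s₁ - s)) ^ 2 ≤
      (1 - ((1 / 2 : ℝ) ^ (s₁ - s)) ^ 2)⁻¹ := by
  have hw := weight_pos ξ
  obtain ⟨n, h1, h2, -⟩ := exists_annulus_eq ξ
  rw [← Finset.sum_filter_add_sum_filter_not A (fun k ↦ n + 1 ≤ k)]
  have hz : ∑ k ∈ A with ¬ n + 1 ≤ k,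
      ((2 ^ k : ℝ) ^ (s - s₁)) ^ 2 * (low k ξ * weight ξ ^ (s₁ - s)) ^ 2 = 0 := by
    refine Finset.sum_eq_zero fun k hk ↦ ?_
    have hk' : ¬ weight ξ < 2 ^ k := fun hlt ↦ (Finset.mem_filter.1 hk).2
      ((pow_lt_pow_iff_right₀ (one_lt_two (α := ℝ))).1 (h1.trans_lt hlt))
    rw [low, if_neg hk']
    simp
  rw [hz, add_zero]
  refine le_trans (Finset.sum_le_sum fun k hk ↦ ?_) (sum_geometric_comp_le (sub_pos.2 h)
    (A.filter fun k ↦ n + 1 ≤ k) (fun k ↦ k - (n + 1)) fun a ha b hb hab ↦ ?_)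
  · have hk' : n + 1 ≤ k := (Finset.mem_filter.1 hk).2
    have e : (2 ^ k : ℝ) ^ (s - s₁) * weight ξ ^ (s₁ - s) = (weight ξ / 2 ^ k) ^ (s₁ - s) := by
      rw [Real.div_rpow hw.le (by positivity), ← neg_sub s₁ s, Real.rpow_neg (by positivity),
        div_eq_inv_mul]
    rw [← mul_pow, mul_left_comm, e]
    have hq : weight ξ / 2 ^ k ≤ (1 / 2 : ℝ) ^ (k - (n + 1)) := by
      rw [one_div, inv_pow, div_le_iff₀ (by positivity), ← div_eq_inv_mul,
        le_div_iff₀ (by positivity)]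
      calc weight ξ * 2 ^ (k - (n + 1)) ≤ 2 ^ (n + 1) * 2 ^ (k - (n + 1)) := by gcongr
        _ = 2 ^ k := by rw [← pow_add, Nat.add_sub_cancel' hk']
    have hl : 0 ≤ low k ξ ∧ low k ξ ≤ 1 := by
      unfold low
      split_ifs <;> simp
    have hr : (weight ξ / 2 ^ k) ^ (s₁ - s) ≤ ((1 / 2 : ℝ) ^ (k - (n + 1))) ^ (s₁ - s) :=
      Real.rpow_le_rpow (by positivity) hq (sub_pos.2 h).le
    exact pow_le_pow_left₀ (mul_nonneg hl.1 (by positivity))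
      ((mul_le_of_le_one_left (by positivity) hl.2).trans hr) 2
  · have ha' := (Finset.mem_filter.1 (Finset.mem_coe.1 ha)).2
    have hb' := (Finset.mem_filter.1 (Finset.mem_coe.1 hb)).2
    simp only at hab
    omega

/-- The mirror image of `sum_low_le`: only `k ≤ n` contribute, with geometric decay in `n - k`
because `s₀ < s`. -/
theorem sum_high_le {d : ℕ} {s₀ s : ℝ} (h : s₀ < s) (A : Finset ℕ) (ξ : Space d) :
    ∑ k ∈ A, ((2 ^ k : ℝ) ^ (s - s₀)) ^ 2 * (high k ξ * weight ξ ^ (s₀ - s)) ^ 2 ≤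
      (1 - ((1 / 2 : ℝ) ^ (s - s₀)) ^ 2)⁻¹ := by
  have hw := weight_pos ξ
  obtain ⟨n, h1, h2, -⟩ := exists_annulus_eq ξ
  rw [← Finset.sum_filter_add_sum_filter_not A (fun k ↦ k ≤ n)]
  have hz : ∑ k ∈ A with ¬ k ≤ n,
      ((2 ^ k : ℝ) ^ (s - s₀)) ^ 2 * (high k ξ * weight ξ ^ (s₀ - s)) ^ 2 = 0 := by
    refine Finset.sum_eq_zero fun k hk ↦ ?_
    have hk' : n + 1 ≤ k := not_le.1 (Finset.mem_filter.1 hk).2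
    rw [high, if_pos (h2.trans_le (pow_le_pow_right₀ one_le_two hk'))]
    simp
  rw [hz, add_zero]
  refine le_trans (Finset.sum_le_sum fun k hk ↦ ?_) (sum_geometric_comp_le (sub_pos.2 h)
    (A.filter fun k ↦ k ≤ n) (fun k ↦ n - k) fun a ha b hb hab ↦ ?_)
  · have hk' : k ≤ n := (Finset.mem_filter.1 hk).2
    have e : (2 ^ k : ℝ) ^ (s - s₀) * weight ξ ^ (s₀ - s) = (2 ^ k / weight ξ) ^ (s - s₀) := by
      rw [Real.div_rpow (by positivity) hw.le, ← neg_sub s s₀, Real.rpow_neg hw.le,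
        div_eq_mul_inv]
    rw [← mul_pow, mul_left_comm, e]
    have hq : 2 ^ k / weight ξ ≤ (1 / 2 : ℝ) ^ (n - k) := by
      rw [one_div, inv_pow, div_le_iff₀ hw, ← div_eq_inv_mul, le_div_iff₀ (by positivity),
        ← pow_add, Nat.add_sub_cancel' hk']
      exact h1
    have hl : 0 ≤ high k ξ ∧ high k ξ ≤ 1 := by
      unfold high
      split_ifs <;> simp
    have hr : (2 ^ k / weight ξ) ^ (s - s₀) ≤ ((1 / 2 : ℝ) ^ (n - k)) ^ (s - s₀) :=
      Real.rpow_le_rpow (by positivity) hq (sub_pos.2 h).le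
    exact pow_le_pow_left₀ (mul_nonneg hl.1 (by positivity))
      ((mul_le_of_le_one_left (by positivity) hl.2).trans hr) 2
  · have h1 := (Finset.mem_filter.1 (Finset.mem_coe.1 ha)).2
    have h2 := (Finset.mem_filter.1 (Finset.mem_coe.1 hb)).2
    simp only at hab
    omega

theorem SobolevSpace.exists_sum_freqMass_le {d : ℕ} {s₀ s s₁ : ℝ} (h₀ : s₀ < s) (h₁ : s < s₁) :
    ∃ C : ℝ, 0 ≤ C ∧ ∀ (A : Finset ℕ) (v : SobolevSpace d s),
      ∑ k ∈ A, freqMass s₀ s₁ k v ≤ C * ‖v‖ ^ 2 := by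
  -- The constant is nonnegative because it bounds the empty sum.
  have hpos : ∀ {δ : ℝ}, 0 < δ → 0 ≤ (1 - ((1 / 2 : ℝ) ^ δ) ^ 2)⁻¹ := fun {δ} hδ ↦
    le_trans (by simp) (sum_geometric_comp_le hδ ∅ id (by simp))
  refine ⟨_, add_nonneg (hpos (sub_pos.2 h₁)) (hpos (sub_pos.2 h₀)), fun A v ↦ ?_⟩
  simp only [freqMass, mul_pow, Finset.sum_add_distrib, add_mul]
  exact add_le_add
    (sum_norm_sq_fmul_le A (fun k _ ↦ isSymbol_low k _) _ (sum_low_le h₁ A) v)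
    (sum_norm_sq_fmul_le A (fun k _ ↦ isSymbol_high k (by linarith)) _ (sum_high_le h₀ A) v)

/-! ### Square function inequalities in `L^p` for `p ≥ 2`, and square summable series. -/

theorem eLpNorm_sq_eq_eLpNorm_half {α E : Type*} [MeasurableSpace α] {ν : Measure α}
    [NormedAddCommGroup E] (p : ℝ≥0∞) (f : α → E) :
    eLpNorm f p ν ^ 2 = eLpNorm (fun x ↦ ‖f x‖ ^ (2 : ℝ)) (p / 2) ν := by
  have hp2 : p / 2 * ENNReal.ofReal 2 = p := by
    rw [ENNReal.ofReal_ofNat, ENNReal.div_mul_cancel two_ne_zero ENNReal.ofNat_ne_top]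
  rw [eLpNorm_norm_rpow f two_pos, hp2, ENNReal.rpow_ofNat]

/-- Minkowski's inequality in `L^{p/2}` applied to the squared norms; `p ≥ 2` is what makes `p/2` an
admissible exponent. -/
theorem eLpNorm_sq_le_sum {α E F ι : Type*} [MeasurableSpace α] {ν : Measure α}
    [NormedAddCommGroup E] [NormedAddCommGroup F] {p : ℝ≥0∞} (hp : 2 ≤ p) (A : Finset ι)
    {f : ι → α → E} {g : α → F} (hf : ∀ i ∈ A, AEStronglyMeasurable (f i) ν)
    (h : ∀ᵐ x ∂ν, ‖g x‖ ^ 2 ≤ ∑ i ∈ A, ‖f i x‖ ^ 2) :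
    eLpNorm g p ν ^ 2 ≤ ∑ i ∈ A, eLpNorm (f i) p ν ^ 2 := by
  have h1p : 1 ≤ p / 2 := by
    rwa [ENNReal.le_div_iff_mul_le (Or.inl two_ne_zero) (Or.inl ENNReal.ofNat_ne_top), one_mul]
  have hmeas : ∀ i ∈ A, AEStronglyMeasurable (fun x ↦ ‖f i x‖ ^ (2 : ℝ)) ν := fun i hi ↦ by
    simp_rw [Real.rpow_ofNat]
    exact (hf i hi).norm.pow 2
  have hle : eLpNorm (fun x ↦ ‖g x‖ ^ (2 : ℝ)) (p / 2) ν ≤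
      eLpNorm (∑ i ∈ A, fun x ↦ ‖f i x‖ ^ (2 : ℝ)) (p / 2) ν := by
    refine eLpNorm_mono_ae ?_
    filter_upwards [h] with x hx
    simp_rw [Finset.sum_apply, Real.rpow_ofNat]
    rwa [Real.norm_of_nonneg (sq_nonneg _),
      Real.norm_of_nonneg (Finset.sum_nonneg fun i _ ↦ sq_nonneg _)]
  rw [eLpNorm_sq_eq_eLpNorm_half p g,
    Finset.sum_congr rfl fun i _ ↦ eLpNorm_sq_eq_eLpNorm_half p (f i)]
  exact hle.trans (eLpNorm_sum_le hmeas h1p)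

theorem Lp_norm_sq_le_sum {α E F ι : Type*} [MeasurableSpace α] {ν : Measure α}
    [NormedAddCommGroup E] [NormedAddCommGroup F] {p : ℝ≥0∞} (hp : 2 ≤ p) (A : Finset ι)
    (f : ι → Lp E p ν) (g : Lp F p ν)
    (h : ∀ᵐ x ∂ν, ‖g x‖ ^ 2 ≤ ∑ i ∈ A, ‖f i x‖ ^ 2) :
    ‖g‖ ^ 2 ≤ ∑ i ∈ A, ‖f i‖ ^ 2 := by
  have h1 := eLpNorm_sq_le_sum hp A (fun i _ ↦ Lp.aestronglyMeasurable (f i)) h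
  have h2 := ENNReal.toReal_mono (ENNReal.sum_ne_top.2 fun i _ ↦
    ENNReal.pow_ne_top (Lp.eLpNorm_ne_top (f i))) h1
  rw [ENNReal.toReal_sum fun i _ ↦ ENNReal.pow_ne_top (Lp.eLpNorm_ne_top (f i))] at h2
  simpa only [ENNReal.toReal_pow, ← Lp.norm_def] using h2

theorem ae_norm_le_norm_Lp_top {α E : Type*} [MeasurableSpace α] {ν : Measure α}
    [NormedAddCommGroup E] (f : Lp E ⊤ ν) : ∀ᵐ x ∂ν, ‖f x‖ ≤ ‖f‖ := by
  filter_upwards [ae_le_eLpNormEssSup (f := f) (μ := ν)] with x hx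
  rw [← eLpNorm_exponent_top] at hx
  rw [Lp.norm_def, ← toReal_enorm]
  exact ENNReal.toReal_mono (Lp.eLpNorm_ne_top f) hx

/-- Cauchy's criterion in squared form: almost orthogonality replaces absolute convergence, which
may fail. -/
theorem summable_of_norm_sq_sum_le {E : Type*} [NormedAddCommGroup E] [CompleteSpace E]
    {f : ℕ → E} {b : ℕ → ℝ} (hb : Summable b)
    (h : ∀ A : Finset ℕ, ‖∑ k ∈ A, f k‖ ^ 2 ≤ ∑ k ∈ A, b k) : Summable f := by
  rw [summable_iff_vanishing_norm]
  intro ε hε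
  obtain ⟨S, hS⟩ := summable_iff_vanishing_norm.1 hb (ε ^ 2) (by positivity)
  refine ⟨S, fun A hA ↦ lt_of_pow_lt_pow_left₀ 2 hε.le ((h A).trans_lt ?_)⟩
  exact (le_abs_self _).trans_lt (hS A hA)

theorem norm_sq_tsum_sub_le {E : Type*} [NormedAddCommGroup E] {f : ℕ → E} {b : ℕ → ℝ}
    (hf : Summable f) (h : ∀ A : Finset ℕ, ‖∑ k ∈ A, f k‖ ^ 2 ≤ ∑ k ∈ A, b k) (K : ℕ) {c : ℝ}
    (hc : ∀ A : Finset ℕ, (∀ k ∈ A, K ≤ k) → ∑ k ∈ A, b k ≤ c) :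
    ‖∑' k, f k - ∑ k ∈ Finset.range K, f k‖ ^ 2 ≤ c := by
  have ht : Tendsto (fun n ↦ ‖∑ k ∈ Finset.range n, f k - ∑ k ∈ Finset.range K, f k‖ ^ 2) atTop
      (𝓝 (‖∑' k, f k - ∑ k ∈ Finset.range K, f k‖ ^ 2)) :=
    ((hf.hasSum.tendsto_sum_nat.sub_const _).norm).pow 2
  refine le_of_tendsto ht ?_
  filter_upwards [eventually_ge_atTop K] with n hn
  rw [← Finset.sum_Ico_eq_sub _ hn]
  exact (h _).trans (hc _ fun k hk ↦ (Finset.mem_Ico.1 hk).1)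

open SobolevSpace

/-! ### Fourier multipliers on functions of time. -/

section Time

variable {d : ℕ} {T : ℝ} {μ : ℝ≥0∞} [Fact (1 ≤ μ)]

/-- The Fourier multiplier `û ↦ m û` acting on functions of time. -/
def timeMul (T : ℝ) (μ : ℝ≥0∞) [Fact (1 ≤ μ)] (s σ : ℝ) (m : Space d → ℝ) :
    TimeSobolev d T μ s →L[ℂ] TimeSobolev d T μ σ :=
  (fmul s σ m).compLpL μ (timeMeasure T)

theorem coeFn_timeMul (s σ : ℝ) (m : Space d → ℝ) (f : TimeSobolev d T μ s) :
    ∀ᵐ t ∂(timeMeasure T), timeMul T μ s σ m f t = fmul s σ m (f t) :=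
  ContinuousLinearMap.coeFn_compLpL (fmul s σ m) f

theorem norm_timeMul_le {s σ C : ℝ} {m : Space d → ℝ}
    (h : ∀ u, ‖fmul s σ m u‖ ≤ C * ‖u‖) (f : TimeSobolev d T μ s) :
    ‖timeMul T μ s σ m f‖ ≤ C * ‖f‖ := by
  refine Lp.norm_le_mul_norm_of_ae_le_mul ?_
  filter_upwards [coeFn_timeMul s σ m f] with t ht
  rw [ht]
  exact h _

theorem timeMul_eq_of_sameFunction {s σ τ : ℝ} {m : Space d → ℝ} (hs : IsSymbol (τ - s) m)
    (hσ : IsSymbol (τ - σ) m) {f : TimeSobolev d T μ s} {g : TimeSobolev d T μ σ}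
    (h : SameFunction f g) : timeMul T μ s τ m f = timeMul T μ σ τ m g := by
  apply Lp.ext
  filter_upwards [h, coeFn_timeMul s τ m f, coeFn_timeMul σ τ m g] with t h1 h2 h3
  rw [h2, h3, fmul_eq_of_toDist_eq hs hσ h1]

theorem norm_sq_sum_timeMul_le (hμ : 2 ≤ μ) (s σ : ℝ) (f : TimeSobolev d T μ s) (A : Finset ℕ) :
    ‖∑ k ∈ A, timeMul T μ s σ (annulus k) f‖ ^ 2 ≤
      ∑ k ∈ A, ‖timeMul T μ s σ (annulus k) f‖ ^ 2 := by
  refine Lp_norm_sq_le_sum hμ A _ _ ?_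
  have h : ∀ k ∈ A, ∀ᵐ t ∂(timeMeasure T),
      timeMul T μ s σ (annulus k) f t = fmul s σ (annulus k) (f t) :=
    fun k _ ↦ coeFn_timeMul s σ (annulus k) f
  rw [← Finset.eventually_all] at h
  filter_upwards [h, Lp.coeFn_finsetSum A fun k ↦ timeMul T μ s σ (annulus k) f] with t h1 h2
  have h3 : ∑ k ∈ A, ‖timeMul T μ s σ (annulus k) f t‖ ^ 2 =
      ∑ k ∈ A, ‖fmul s σ (annulus k) (f t)‖ ^ 2 :=
    Finset.sum_congr rfl fun k hk ↦ by rw [h1 k hk]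
  rw [h2, Finset.sum_apply, Finset.sum_congr rfl h1, h3]
  exact norm_sq_sum_annulus_le A (f t)

theorem timeMul_annulus_annulus (s σ τ : ℝ) (k l : ℕ) (f : TimeSobolev d T μ s) :
    timeMul T μ σ τ (annulus l) (timeMul T μ s σ (annulus k) f) =
      if k = l then timeMul T μ s τ (annulus l) f else 0 := by
  have h : ∀ᵐ t ∂(timeMeasure T),
      timeMul T μ σ τ (annulus l) (timeMul T μ s σ (annulus k) f) t =
        if k = l then fmul s τ (annulus l) (f t) else 0 := by
    filter_upwards [coeFn_timeMul σ τ (annulus l) (timeMul T μ s σ (annulus k) f),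
      coeFn_timeMul s σ (annulus k) f] with t h1 h2
    rw [h1, h2, fmul_annulus_annulus]
  apply Lp.ext
  split_ifs with hkl
  · filter_upwards [h, coeFn_timeMul s τ (annulus l) f] with t h1 h2
    rw [h1, h2, if_pos hkl]
  · filter_upwards [h, Lp.coeFn_zero (SobolevSpace d τ) μ (timeMeasure T)] with t h1 h2
    rw [h1, h2, if_neg hkl, Pi.zero_apply]

/-- Applying one annulus cutoff to the sum leaves a single term, by continuity and disjointness, and
the cutoffs together determine a distribution. -/
theorem sameFunction_tsum_annulus {s σ : ℝ} {f : TimeSobolev d T μ s}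
    (hf : Summable fun k ↦ timeMul T μ s σ (annulus k) f) :
    SameFunction (∑' k, timeMul T μ s σ (annulus k) f) f := by
  set g := ∑' k, timeMul T μ s σ (annulus k) f with hg
  have h : ∀ l : ℕ, timeMul T μ σ s (annulus l) g = timeMul T μ s s (annulus l) f := by
    intro l
    rw [hg, ContinuousLinearMap.map_tsum _ hf]
    simp_rw [timeMul_annulus_annulus]
    rw [tsum_ite_eq]
  have h' : ∀ l : ℕ, ∀ᵐ t ∂(timeMeasure T),
      fmul σ s (annulus l) (g t) = fmul s s (annulus l) (f t) := by
    intro l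
    filter_upwards [coeFn_timeMul σ s (annulus l) g, coeFn_timeMul s s (annulus l) f] with t h1 h2
    rw [← h1, ← h2, h l]
  filter_upwards [ae_all_iff.2 h'] with t ht
  exact toDist_eq_of_fmul_annulus_eq s ht

/-! ### The frequency localised estimate. -/

/-- Frequency localised estimate for a map which is Lipschitz in `H^{s₀}` and tame in `H^{s₁}`. -/
theorem exists_norm_sq_timeMul_le {s₀ s s₁ r : ℝ} (hs₀ : s₀ < s) (hs₁ : s < s₁)
    {u₀ : SobolevSpace d s} {Φ : Metric.ball u₀ r → TimeSobolev d T μ s₀}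
    (weak_lipschitz : ∃ C₀ : ℝ, 0 < C₀ ∧ ∀ v w : Metric.ball u₀ r,
      ‖Φ v - Φ w‖ ≤ C₀ * ‖SobolevSpace.incl hs₀.le (v.1 - w.1)‖)
    (tame : ∃ C₁ : ℝ, 0 < C₁ ∧ ∀ v : Metric.ball u₀ r,
      ∀ hv : ∀ σ : ℝ, v.1.toDist ∈ sobolevSubmodule d σ,
        ∃ g : TimeSobolev d T μ s₁, SameFunction g (Φ v) ∧
          ‖g‖ ≤ C₁ * ‖SobolevSpace.mk v.1.toDist (hv s₁)‖) :
    ∃ K : ℝ, 0 ≤ K ∧ ∀ (k : ℕ) (m : Space d → ℝ), IsDyadic k m → ∀ v : Metric.ball u₀ r,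
      fmul s s (low k) v.1 ∈ Metric.ball u₀ r →
        ‖timeMul T μ s₀ s m (Φ v)‖ ^ 2 ≤ K * freqMass s₀ s₁ k v.1 := by
  obtain ⟨C₀, hC₀, hL⟩ := weak_lipschitz
  obtain ⟨C₁, hC₁, hT⟩ := tame
  -- Each summand is the square of a Bernstein constant times the constant of the tame, respectively
  -- Lipschitz, hypothesis, as Cauchy–Schwarz will require.
  refine ⟨(4 ^ (s₁ - s) * C₁) ^ 2 + (2 ^ (s - s₀) * C₀) ^ 2, by positivity,
    fun k m hm v hv ↦ ?_⟩
  -- The comparison point `w` is the truncation of `v` below frequency `2^k`. Its bounded frequency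
  -- support puts it in every Sobolev space, so the tame estimate applies to it.
  obtain ⟨w, hw⟩ : ∃ w : Metric.ball u₀ r, w.1 = fmul s s (low k) v.1 := ⟨⟨_, hv⟩, rfl⟩
  have hlow : ∀ σ, (fmul s σ (low k) v.1).toDist = w.1.toDist := fun σ ↦ by
    rw [hw]
    exact toDist_fmul (isSymbol_low k _) (isSymbol_low k _) v.1
  have hmem : ∀ σ : ℝ, w.1.toDist ∈ sobolevSubmodule d σ := fun σ ↦ by
    rw [← hlow σ]
    exact toDist_mem _
  obtain ⟨g, hg, hgn⟩ := hT w hmem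
  have hmk : SobolevSpace.mk w.1.toDist (hmem s₁) = fmul s s₁ (low k) v.1 :=
    toDist_injective ((toDist_mk _ _).trans (hlow s₁).symm)
  have h1 : ‖timeMul T μ s₀ s m (Φ w)‖ ≤
      4 ^ (s₁ - s) * (2 ^ k : ℝ) ^ (s - s₁) * (C₁ * ‖fmul s s₁ (low k) v.1‖) := by
    rw [← timeMul_eq_of_sameFunction (hm.isSymbol _) (hm.isSymbol _) hg, ← hmk]
    exact (norm_timeMul_le (hm.norm_fmul_le_of_ge hs₁.le) g).trans
      (mul_le_mul_of_nonneg_left hgn (by positivity))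
  have h2 : ‖timeMul T μ s₀ s m (Φ v - Φ w)‖ ≤
      2 ^ (s - s₀) * (2 ^ k : ℝ) ^ (s - s₀) * (C₀ * ‖fmul s s₀ (high k) v.1‖) := by
    rw [← sub_fmul_low hs₀.le, ← hw]
    exact (norm_timeMul_le (hm.norm_fmul_le_of_le hs₀.le) _).trans
      (mul_le_mul_of_nonneg_left (hL v w) (by positivity))
  have h3 : ‖timeMul T μ s₀ s m (Φ v)‖ ≤
      ‖timeMul T μ s₀ s m (Φ w)‖ + ‖timeMul T μ s₀ s m (Φ v - Φ w)‖ := by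
    refine le_trans (le_of_eq ?_) (norm_add_le _ _)
    rw [← map_add, add_sub_cancel]
  have h4 := pow_le_pow_left₀ (norm_nonneg _) (h3.trans (add_le_add h1 h2)) 2
  refine h4.trans ?_
  unfold freqMass
  generalize (2 ^ k : ℝ) ^ (s - s₁) = x₁
  generalize (2 ^ k : ℝ) ^ (s - s₀) = x₂
  generalize (4 : ℝ) ^ (s₁ - s) = x₃
  generalize (2 : ℝ) ^ (s - s₀) = x₄
  generalize ‖fmul s s₁ (low k) v.1‖ = y₁
  generalize ‖fmul s s₀ (high k) v.1‖ = y₂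
  -- Cauchy–Schwarz in the plane, by Lagrange's identity: the defect is exactly this square.
  linear_combination sq_nonneg ((x₃ * C₁) * (x₂ * y₂) - (x₄ * C₀) * (x₁ * y₁))

theorem summable_freqMass {s₀ s s₁ : ℝ} (hs₀ : s₀ < s) (hs₁ : s < s₁) (v : SobolevSpace d s) :
    Summable fun k ↦ freqMass s₀ s₁ k v := by
  obtain ⟨C, -, hC⟩ := exists_sum_freqMass_le (d := d) hs₀ hs₁
  exact summable_of_sum_le (fun k ↦ freqMass_nonneg _ _ _ _) (fun A ↦ hC A v)

/-- Low frequency truncations stay in the ball, locally uniformly. -/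
theorem exists_fmul_low_mem_ball {s r : ℝ} {u₀ : SobolevSpace d s} (v : Metric.ball u₀ r) :
    ∃ N : ℕ, ∃ ρ > 0, ∀ w : Metric.ball u₀ r, ‖w.1 - v.1‖ < ρ → ∀ k ≥ N,
      fmul s s (low k) w.1 ∈ Metric.ball u₀ r := by
  have hv := v.2
  rw [mem_ball_iff_norm] at hv
  -- Half of the distance to the boundary pays for truncating `v`, the other half for replacing `v`
  -- by `w`, since truncation does not increase the norm of `w - v`.
  have hpos : 0 < (r - ‖v.1 - u₀‖) / 2 := by linarith
  obtain ⟨N, hN⟩ := Metric.tendsto_atTop.1 (tendsto_fmul_low v.1) _ hpos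
  refine ⟨N, _, hpos, fun w hw k hk ↦ ?_⟩
  have h1 := hN k hk
  rw [dist_eq_norm] at h1
  have h2 : ‖fmul s s (low k) (w.1 - v.1)‖ ≤ 1 * ‖w.1 - v.1‖ :=
    norm_fmul_le (measurable_low k) (fun ξ ↦ by simpa using abs_low_le k ξ) _
  rw [mem_ball_iff_norm]
  have e : fmul s s (low k) w.1 - u₀ =
      fmul s s (low k) (w.1 - v.1) + (fmul s s (low k) v.1 - v.1) + (v.1 - u₀) := by
    rw [map_sub]
    abel
  rw [e]
  have h3 := norm_add₃_le (a := fmul s s (low k) (w.1 - v.1))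
    (b := fmul s s (low k) v.1 - v.1) (c := v.1 - u₀)
  linarith

/-! ### Convergence of the dyadic series and continuity in the data. -/

section Localized

variable {s₀ s s₁ r K : ℝ} {u₀ : SobolevSpace d s}
  {Φ : Metric.ball u₀ r → TimeSobolev d T μ s₀}

/-- The estimate is available only once the truncation lies in the ball; the finitely many earlier
indices do not affect summability. Any dyadic family is allowed, so that sharp annuli and
Littlewood–Paley blocks are both covered. -/
theorem summable_norm_sq_timeMul (hs₀ : s₀ < s) (hs₁ : s < s₁)
    (hK : ∀ (k : ℕ) (m : Space d → ℝ), IsDyadic k m → ∀ v : Metric.ball u₀ r,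
      fmul s s (low k) v.1 ∈ Metric.ball u₀ r →
        ‖timeMul T μ s₀ s m (Φ v)‖ ^ 2 ≤ K * freqMass s₀ s₁ k v.1)
    {m : ℕ → Space d → ℝ} (hm : ∀ k, IsDyadic k (m k)) (v : Metric.ball u₀ r) :
    Summable fun k ↦ ‖timeMul T μ s₀ s (m k) (Φ v)‖ ^ 2 := by
  obtain ⟨N, ρ, hρ, hN⟩ := exists_fmul_low_mem_ball v
  refine Summable.of_norm_bounded_eventually_nat ((summable_freqMass hs₀ hs₁ v.1).mul_left K) ?_
  filter_upwards [eventually_ge_atTop N] with k hk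
  rw [Real.norm_of_nonneg (sq_nonneg _)]
  exact hK k (m k) (hm k) v (hN v (by simpa using hρ) k hk)

theorem summable_timeMul_annulus (hμ : 2 ≤ μ) (hs₀ : s₀ < s) (hs₁ : s < s₁)
    (hK : ∀ (k : ℕ) (m : Space d → ℝ), IsDyadic k m → ∀ v : Metric.ball u₀ r,
      fmul s s (low k) v.1 ∈ Metric.ball u₀ r →
        ‖timeMul T μ s₀ s m (Φ v)‖ ^ 2 ≤ K * freqMass s₀ s₁ k v.1)
    (v : Metric.ball u₀ r) : Summable fun k ↦ timeMul T μ s₀ s (annulus k) (Φ v) :=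
  summable_of_norm_sq_sum_le (summable_norm_sq_timeMul hs₀ hs₁ hK isDyadic_annulus v)
    (norm_sq_sum_timeMul_le hμ s₀ s (Φ v))

/-- Partial sums are continuous since `Φ` is continuous into the weaker space and each cutoff maps
it boundedly into `H^s`; near each point they approximate the full sum uniformly. -/
theorem continuous_tsum_timeMul_annulus (hμ : 2 ≤ μ) (hs₀ : s₀ < s) (hs₁ : s < s₁)
    (hΦ : Continuous Φ) (hK0 : 0 ≤ K)
    (hK : ∀ (k : ℕ) (m : Space d → ℝ), IsDyadic k m → ∀ v : Metric.ball u₀ r,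
      fmul s s (low k) v.1 ∈ Metric.ball u₀ r →
        ‖timeMul T μ s₀ s m (Φ v)‖ ^ 2 ≤ K * freqMass s₀ s₁ k v.1) :
    Continuous fun v ↦ ∑' k, timeMul T μ s₀ s (annulus k) (Φ v) := by
  refine continuous_of_locally_uniform_approx_of_continuousAt fun v U hU ↦ ?_
  obtain ⟨ε, hε, hεU⟩ := Metric.mem_uniformity_dist.1 hU
  obtain ⟨N, ρ, hρ, hN⟩ := exists_fmul_low_mem_ball v
  obtain ⟨C, hC0, hC⟩ := exists_sum_freqMass_le (d := d) hs₀ hs₁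
  -- The squared tail will be at most `2K(C + 1)η`, so this choice keeps it below `ε²`; adding `1`
  -- to `K` and `C` avoids division by zero.
  have hη : 0 < ε ^ 2 / (8 * (K + 1) * (C + 1)) := by positivity
  set η := ε ^ 2 / (8 * (K + 1) * (C + 1)) with hηdef
  obtain ⟨S, hS⟩ := summable_iff_vanishing_norm.1 (summable_freqMass hs₀ hs₁ v.1) η hη
  -- Indices from `M` on are past `N`, where the estimate holds for all nearby `w`, and lie outside
  -- `S`, where the tail at `v` is below `η`.
  set M := max N (S.sup id + 1) with hM
  have hρ' : 0 < min ρ (√η) := lt_min hρ (Real.sqrt_pos.2 hη)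
  refine ⟨Metric.ball v (min ρ (√η)), Metric.ball_mem_nhds v hρ',
    fun w ↦ ∑ k ∈ Finset.range M, timeMul T μ s₀ s (annulus k) (Φ w), ?_, fun w hw ↦ hεU ?_⟩
  · exact (continuous_finsetSum _ fun k _ ↦
      (timeMul T μ s₀ s (annulus k)).continuous.comp hΦ).continuousAt
  · rw [Metric.mem_ball, Subtype.dist_eq, dist_eq_norm] at hw
    have hwη : ‖w.1 - v.1‖ ^ 2 ≤ η := by
      rw [← Real.sq_sqrt hη.le]
      exact pow_le_pow_left₀ (norm_nonneg _) (hw.le.trans (min_le_right _ _)) 2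
    rw [dist_eq_norm]
    refine lt_of_pow_lt_pow_left₀ 2 hε.le (lt_of_le_of_lt (norm_sq_tsum_sub_le
      (summable_timeMul_annulus hμ hs₀ hs₁ hK w) (norm_sq_sum_timeMul_le hμ s₀ s (Φ w)) M
      (c := K * (2 * η + 2 * (C * η))) fun A hA ↦ ?_) ?_)
    · have hSA : Disjoint A S := by
        refine Finset.disjoint_left.2 fun k hkA hkS ↦ ?_
        have h1 : k ≤ S.sup id := Finset.le_sup (f := id) hkS
        have h2 := (le_max_right _ _).trans (hA k hkA)
        omega
      have h1 : ∑ k ∈ A, freqMass s₀ s₁ k v.1 ≤ η :=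
        ((le_abs_self _).trans_lt (hS A hSA)).le
      have h2 : ∑ k ∈ A, freqMass s₀ s₁ k (w.1 - v.1) ≤ C * η :=
        (hC A _).trans (mul_le_mul_of_nonneg_left hwη hC0)
      calc ∑ k ∈ A, ‖timeMul T μ s₀ s (annulus k) (Φ w)‖ ^ 2
          ≤ ∑ k ∈ A, K * (2 * freqMass s₀ s₁ k v.1 + 2 * freqMass s₀ s₁ k (w.1 - v.1)) :=
            Finset.sum_le_sum fun k hk ↦ (hK k _ (isDyadic_annulus k) w
              (hN w (hw.trans_le (min_le_left _ _)) k ((le_max_left _ _).trans (hA k hk)))).trans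
              (mul_le_mul_of_nonneg_left (freqMass_le _ _ _ _ _) hK0)
        _ = K * (2 * ∑ k ∈ A, freqMass s₀ s₁ k v.1 +
              2 * ∑ k ∈ A, freqMass s₀ s₁ k (w.1 - v.1)) := by
            rw [← Finset.mul_sum, Finset.sum_add_distrib, ← Finset.mul_sum, ← Finset.mul_sum]
        _ ≤ K * (2 * η + 2 * (C * η)) := by gcongr
    · have e : 8 * ((K + 1) * (C + 1) * η) = ε ^ 2 := by
        rw [hηdef]
        field_simp
      have h0 : 0 ≤ (C + 1) * η := by positivity
      have h1 : 0 < (K + 1) * (C + 1) * η := by positivity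
      nlinarith

end Localized

theorem tsum_eLpNorm_block_lt_top {s₀ s : ℝ} (P : LittlewoodPaley d) {f : TimeSobolev d T μ s₀}
    {g : TimeSobolev d T μ s} (hfg : SameFunction g f)
    (hf : Summable fun j ↦
      ‖timeMul T μ s₀ s (fun ξ ↦ P.symbol j ((2 * Real.pi) • ξ)) f‖ ^ 2) :
    ∑' j : ℕ, eLpNorm (fun t ↦ P.block s j (g t)) μ (timeMeasure T) ^ 2 < ⊤ := by
  have e : ∀ j, eLpNorm (fun t ↦ P.block s j (g t)) μ (timeMeasure T) =
      ENNReal.ofReal ‖timeMul T μ s₀ s (fun ξ ↦ P.symbol j ((2 * Real.pi) • ξ)) f‖ := by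
    intro j
    rw [Lp.norm_def, ENNReal.ofReal_toReal (Lp.eLpNorm_ne_top _)]
    refine eLpNorm_congr_ae ?_
    filter_upwards [hfg, coeFn_timeMul s₀ s (fun ξ ↦ P.symbol j ((2 * Real.pi) • ξ)) f]
      with t h1 h2
    rw [h2, P.block_eq_fmul]
    exact fmul_eq_of_toDist_eq ((P.isDyadic_symbol j).isSymbol _)
      ((P.isDyadic_symbol j).isSymbol _) h1
  have e2 : ∀ j, eLpNorm (fun t ↦ P.block s j (g t)) μ (timeMeasure T) ^ 2 =
      ENNReal.ofReal (‖timeMul T μ s₀ s (fun ξ ↦ P.symbol j ((2 * Real.pi) • ξ)) f‖ ^ 2) :=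
    fun j ↦ by rw [e, ENNReal.ofReal_pow (norm_nonneg _)]
  rw [tsum_congr e2, ← ENNReal.ofReal_tsum_of_nonneg (fun j ↦ sq_nonneg _) hf]
  exact ENNReal.ofReal_lt_top

end Time

/-! ### Frequency localisation on `H^{-∞}`. -/

namespace SobolevNegInf

theorem toDist_injective {d : ℕ} : Function.Injective (toDist (d := d)) :=
  Subtype.val_injective

theorem toDist_ofSobolev {d : ℕ} (s : ℝ) (u : SobolevSpace d s) :
    (ofSobolev s u).toDist = u.toDist :=
  Submodule.coe_inclusion (le_iSup (sobolevSubmodule d) s) u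

theorem exists_ofSobolev_eq {d : ℕ} (x : SobolevNegInf d) :
    ∃ (σ : ℝ) (y : SobolevSpace d σ), ofSobolev σ y = x := by
  have hdir : Directed (· ≤ ·) (sobolevSubmodule d) := fun a b ↦
    ⟨min a b, sobolevSubmodule_anti d (min_le_left a b), sobolevSubmodule_anti d (min_le_right a b)⟩
  obtain ⟨σ, hσ⟩ := (Submodule.mem_iSup_of_directed _ hdir).1 x.2
  exact ⟨σ, SobolevSpace.mk x.1 hσ, toDist_injective (toDist_ofSobolev σ _)⟩

/-- The frequency localisation to the annulus `2^k ≤ ⟨2πξ⟩ < 2^(k+1)`, as a function from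
`H^{-∞}` to `H^s`. -/
def localizeFun {d : ℕ} (s : ℝ) (k : ℕ) (x : SobolevNegInf d) : SobolevSpace d s :=
  fmul x.exists_ofSobolev_eq.choose s (annulus k) x.exists_ofSobolev_eq.choose_spec.choose

/-- Independence of the chosen representative: any Sobolev space containing the distribution gives
the same localisation. -/
theorem localizeFun_eq {d : ℕ} (s : ℝ) (k : ℕ) {σ : ℝ} {y : SobolevSpace d σ}
    {x : SobolevNegInf d} (h : y.toDist = x.toDist) :
    localizeFun s k x = fmul σ s (annulus k) y := by
  refine fmul_eq_of_toDist_eq ((isDyadic_annulus k).isSymbol _) ((isDyadic_annulus k).isSymbol _) ?_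
  rw [h, ← toDist_ofSobolev, x.exists_ofSobolev_eq.choose_spec.choose_spec]

/-- The frequency localisation to the annulus `2^k ≤ ⟨2πξ⟩ < 2^(k+1)`, from `H^{-∞}` to `H^s`. -/
def localize {d : ℕ} (s : ℝ) (k : ℕ) : SobolevNegInf d →ₗ[ℂ] SobolevSpace d s where
  toFun := localizeFun s k
  map_add' x y := by
    obtain ⟨σ, x', rfl⟩ := x.exists_ofSobolev_eq
    obtain ⟨τ, y', rfl⟩ := y.exists_ofSobolev_eq
    have hx : (incl (min_le_left σ τ) x').toDist = (ofSobolev σ x').toDist := by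
      rw [toDist_incl, toDist_ofSobolev]
    have hy : (incl (min_le_right σ τ) y').toDist = (ofSobolev τ y').toDist := by
      rw [toDist_incl, toDist_ofSobolev]
    rw [localizeFun_eq s k hx, localizeFun_eq s k hy, ← map_add]
    exact localizeFun_eq s k (by rw [map_add, map_add, hx, hy])
  map_smul' c x := by
    obtain ⟨σ, x', rfl⟩ := x.exists_ofSobolev_eq
    rw [RingHom.id_apply, localizeFun_eq s k (toDist_ofSobolev σ x').symm, ← map_smul, ← map_smul]
    exact localizeFun_eq s k (toDist_ofSobolev σ _).symm

theorem localize_eq {d : ℕ} (s : ℝ) (k : ℕ) {σ : ℝ} {y : SobolevSpace d σ}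
    {x : SobolevNegInf d} (h : y.toDist = x.toDist) :
    localize s k x = fmul σ s (annulus k) y :=
  localizeFun_eq s k h

/-- The norm of the localised piece is itself one of the seminorms defining the inductive limit
topology, being continuous on each `H^σ`. -/
theorem continuous_localize {d : ℕ} (s : ℝ) (k : ℕ) : Continuous (localize (d := d) s k) := by
  have hw : WithSeminorms (seminorms d) := ⟨rfl⟩
  let p : SeminormIndex d := ⟨(normSeminorm ℂ (SobolevSpace d s)).comp (localize s k), fun σ ↦ by
    have e : ∀ u : SobolevSpace d σ, (normSeminorm ℂ (SobolevSpace d s)).comp (localize s k)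
        (ofSobolev σ u) = ‖fmul σ s (annulus k) u‖ := fun u ↦ by
      rw [Seminorm.comp_apply, localize_eq s k (toDist_ofSobolev σ u).symm, coe_normSeminorm]
    simp_rw [e]
    exact (fmul σ s (annulus k)).continuous.norm⟩
  refine WithSeminorms.continuous_normedSpace_rng _ hw _ ⟨{p}, 1, ?_⟩
  rw [Finset.sup_singleton, one_smul]
  exact le_rfl

theorem norm_sq_sum_localize_le {d : ℕ} (s : ℝ) (x : SobolevNegInf d) (A : Finset ℕ) :
    ‖∑ k ∈ A, localize s k x‖ ^ 2 ≤ ∑ k ∈ A, ‖localize s k x‖ ^ 2 := by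
  obtain ⟨σ, y, rfl⟩ := x.exists_ofSobolev_eq
  simp_rw [localize_eq s _ (toDist_ofSobolev σ y).symm]
  exact norm_sq_sum_annulus_le A y

theorem toDist_tsum_localize {d : ℕ} {s : ℝ} {x : SobolevNegInf d}
    (h : Summable fun k ↦ localize s k x) : (∑' k, localize s k x).toDist = x.toDist := by
  obtain ⟨σ, y, rfl⟩ := x.exists_ofSobolev_eq
  rw [toDist_ofSobolev]
  refine toDist_eq_of_fmul_annulus_eq s fun l ↦ ?_
  rw [ContinuousLinearMap.map_tsum _ h]
  simp_rw [localize_eq s _ (toDist_ofSobolev σ y).symm, fmul_annulus_annulus]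
  rw [tsum_ite_eq]

end SobolevNegInf

/-! ### Continuity in time. -/

/-- An almost everywhere bound on `(0,T)` for a continuous function holds on `[0,T]`. -/
theorem norm_le_of_ae_timeMeasure {E : Type*} [NormedAddCommGroup E] {T : ℝ} (hT : 0 < T)
    {f : ℝ → E} (hf : ContinuousOn f (Icc 0 T)) {b : ℝ}
    (h : ∀ᵐ t ∂(timeMeasure T), ‖f t‖ ≤ b) : ∀ t ∈ Icc 0 T, ‖f t‖ ≤ b := by
  -- A subset of full measure is dense, since nonempty open sets have positive Lebesgue measure.
  have hd : Icc 0 T ⊆ closure (Ioo 0 T ∩ {t | ‖f t‖ ≤ b}) := by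
    rw [← closure_Ioo hT.ne]
    refine closure_minimal (fun t ht ↦ ?_) isClosed_closure
    rw [mem_closure_iff]
    intro U hU htU
    by_contra hne
    rw [timeMeasure, ae_restrict_iff' measurableSet_Ioo] at h
    have hz : volume (U ∩ Ioo 0 T) = 0 :=
      measure_mono_null (t := {x | ¬(x ∈ Ioo 0 T → ‖f x‖ ≤ b)})
        (fun x hx hx' ↦ hne ⟨x, hx.1, hx.2, hx' hx.2⟩) (ae_iff.1 h)
    exact ((hU.inter isOpen_Ioo).measure_pos volume ⟨t, htU, ht⟩).ne' hz
  intro t ht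
  have hcl : ContinuousWithinAt f (Ioo 0 T ∩ {t | ‖f t‖ ≤ b}) t :=
    (hf t ht).mono (inter_subset_left.trans Ioo_subset_Icc_self)
  have hmem := hcl.norm.mem_closure (hd ht) (t := Iic b) (fun x hx ↦ hx.2)
  rwa [isClosed_Iic.closure_eq] at hmem

/-- The pieces are continuous in time, so their almost everywhere bounds hold at every time.
Orthogonality at each fixed time then makes the series converge in the Banach space of continuous
functions from `[0,T]` to `H^s`. -/
theorem exists_continuousOn_of_summable {d : ℕ} {T : ℝ} (hT : 0 < T) {s : ℝ}
    {u : ℝ → SobolevNegInf d} (hu : ContinuousOn u (Icc 0 T)) {b : ℕ → ℝ}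
    (hb : Summable fun k ↦ b k ^ 2)
    (h : ∀ k, ∀ᵐ t ∂(timeMeasure T), ‖SobolevNegInf.localize s k (u t)‖ ≤ b k) :
    ∃ w : ℝ → SobolevSpace d s, ContinuousOn w (Icc 0 T) ∧
      ∀ t ∈ Icc 0 T, (w t).toDist = (u t).toDist := by
  have hc : ∀ k, ContinuousOn (fun t ↦ SobolevNegInf.localize s k (u t)) (Icc 0 T) := fun k ↦
    (SobolevNegInf.continuous_localize s k).comp_continuousOn hu
  have hle : ∀ k, ∀ t ∈ Icc 0 T, ‖SobolevNegInf.localize s k (u t)‖ ≤ b k := fun k ↦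
    norm_le_of_ae_timeMeasure hT (hc k) (h k)
  let F : ℕ → C(Icc 0 T, SobolevSpace d s) := fun k ↦
    ⟨fun t ↦ SobolevNegInf.localize s k (u t), (hc k).domRestrict⟩
  have hF : Summable F := by
    refine summable_of_norm_sq_sum_le hb fun A ↦ ?_
    have h0 : 0 ≤ ∑ k ∈ A, b k ^ 2 := Finset.sum_nonneg fun _ _ ↦ sq_nonneg _
    rw [← Real.sq_sqrt h0]
    refine pow_le_pow_left₀ (norm_nonneg _) ?_ 2
    rw [ContinuousMap.norm_le _ (Real.sqrt_nonneg _)]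
    intro t
    rw [ContinuousMap.sum_apply]
    refine Real.le_sqrt_of_sq_le ((SobolevNegInf.norm_sq_sum_localize_le s (u t) A).trans ?_)
    exact Finset.sum_le_sum fun k _ ↦ pow_le_pow_left₀ (norm_nonneg _) (hle k t t.2) 2
  refine ⟨IccExtend hT.le ⇑(∑' k, F k : C(Icc 0 T, SobolevSpace d s)), (ContinuousMap.continuous _).Icc_extend'.continuousOn,
    fun t ht ↦ ?_⟩
  have hsum : Summable fun k ↦ SobolevNegInf.localize s k (u t) :=
    ContinuousMap.summable_apply hF ⟨t, ht⟩
  rw [IccExtend_of_mem _ _ ht, ← ContinuousMap.tsum_apply hF]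
  exact SobolevNegInf.toDist_tsum_localize hsum

end SobolevFlow

end

open SobolevFlow in
theorem theorem1 (d : ℕ) (T : ℝ) (hT : 0 < T) (μ : ℝ≥0∞) [Fact (1 ≤ μ)] (hμ : 2 ≤ μ)
    (s₀ s s₁ r : ℝ) (hs₀ : s₀ < s) (hs₁ : s < s₁) (hr : 0 < r)
    (u₀ : SobolevSpace d s)
    (Φ : Metric.ball u₀ r → TimeSobolev d T μ s₀)
    (weak_lipschitz : ∃ C₀ : ℝ, 0 < C₀ ∧ ∀ v w : Metric.ball u₀ r,
      ‖Φ v - Φ w‖ ≤ C₀ * ‖SobolevSpace.incl hs₀.le (v.1 - w.1)‖)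
    (tame : ∃ C₁ : ℝ, 0 < C₁ ∧ ∀ v : Metric.ball u₀ r,
      ∀ hv : ∀ σ : ℝ, v.1.toDist ∈ sobolevSubmodule d σ,
        ∃ g : TimeSobolev d T μ s₁, SameFunction g (Φ v) ∧
          ‖g‖ ≤ C₁ * ‖SobolevSpace.mk v.1.toDist (hv s₁)‖) :
    (∃ Ψ : Metric.ball u₀ r → TimeSobolev d T μ s,
      (∀ v, SameFunction (Ψ v) (Φ v)) ∧
      Continuous Ψ ∧
      ∀ (P : LittlewoodPaley d) (v : Metric.ball u₀ r),
        ∑' j : ℕ, eLpNorm (fun t ↦ P.block s j (Ψ v t)) μ (timeMeasure T) ^ 2 < ⊤) ∧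
    (μ = ⊤ → ∀ (v : Metric.ball u₀ r) (u : ℝ → SobolevNegInf d),
      ContinuousOn u (Icc 0 T) →
      (∀ᵐ t ∂(timeMeasure T), (u t).toDist = (Φ v t).toDist) →
      ∃ w : ℝ → SobolevSpace d s, ContinuousOn w (Icc 0 T) ∧
        ∀ t ∈ Icc 0 T, (w t).toDist = (u t).toDist) := by
  obtain ⟨K, hK0, hK⟩ := exists_norm_sq_timeMul_le hs₀ hs₁ weak_lipschitz tame
  have hΦ : Continuous Φ := by
    obtain ⟨C₀, hC₀, hL⟩ := weak_lipschitz
    refine (LipschitzWith.of_dist_le_mul (K := ⟨C₀, hC₀.le⟩) fun v w ↦ ?_).continuous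
    rw [dist_eq_norm, Subtype.dist_eq, dist_eq_norm]
    -- The `H^s` norm dominates the `H^{s₀}` norm, so the weak Lipschitz bound gives continuity from
    -- the `H^s` ball.
    exact (hL v w).trans (mul_le_mul_of_nonneg_left (SobolevSpace.norm_incl_le _ _) hC₀.le)
  have hsame := fun v ↦ sameFunction_tsum_annulus (summable_timeMul_annulus hμ hs₀ hs₁ hK v)
  refine ⟨⟨fun v ↦ ∑' k, timeMul T μ s₀ s (annulus k) (Φ v), hsame,
    continuous_tsum_timeMul_annulus hμ hs₀ hs₁ hΦ hK0 hK, fun P v ↦ ?_⟩, fun hμtop v u hu huv ↦ ?_⟩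
  · exact tsum_eLpNorm_block_lt_top P (hsame v)
      (summable_norm_sq_timeMul hs₀ hs₁ hK P.isDyadic_symbol v)
  · refine exists_continuousOn_of_summable hT hu
      (summable_norm_sq_timeMul hs₀ hs₁ hK isDyadic_annulus v) fun k ↦ ?_
    subst hμtop
    filter_upwards [huv, coeFn_timeMul s₀ s (annulus k) (Φ v),
      ae_norm_le_norm_Lp_top (timeMul T ⊤ s₀ s (annulus k) (Φ v))] with t h1 h2 h3
    rwa [SobolevNegInf.localize_eq s k h1.symm, ← h2]
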